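/- **Conventions.** Let $X$ be a topological space, $i\ge 0$ an integer, and $C_\bullet(X)$ the singular chain complex with integer coefficients. On $C_\bullet(X)\otimes C_\bullet(X)$ put $\partial(x\otimes y)=\partial x\otimes y+(-1)^{|x|}x\otimes\partial y$ and $T(x\otimes y)=(-1)^{|x||y|}y\otimes x$. For a singular simplex $\sigma\colon\Delta^p\to X$ and a non-empty $S\subseteq[0,p]=\{0,\dots,p\}$, let $\sigma|_S$ be the restriction of $\sigma$ to the face of $\Delta^p$ with vertex set $S$. For $L\subseteq[0,p]$, let $A_L$ be the set of those $a\in[0,p]\setminus L$ for which $|\{l\in L: l>a\}|$ is odd, and let $B_L=[0,p]\setminus(L\cup A_L)$. Define $\Delta_i^\emptyset\colon C_\bullet(X)\to C_\bullet(X)\otimes C_\bullet(X)$ by $$\Delta_i^\emptyset(\sigma)=\sum_{L\subseteq[0,p],\,|L|=i+1}(-1)^{\varepsilon_L}\,\sigma|_{L\cup A_L}\otimes\sigma|_{L\cup B_L},$$ $$\varepsilon_L=\sum_{b\in B_L}|\{a\in A_L:a<b\}|+\sum_{l\in L}|\{m\in L:m<l\}|+(p+1)|A_L|,$$ and put $\Delta_{-1}^\emptyset=0$.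 (Up to sign, $\Delta_i^\emptyset$ is the Steenrod cup-$i$ coproduct or its opposite.) A *dimension-only formula of degree $i$* is a family $\Phi=(\Phi_p)_{p\ge0}$ of finite formal sums $\Phi_p=\sum_{S,T}c^p_{S,T}\,S\otimes T$, with integers $c^p_{S,T}$, over non-empty $S,T\subseteq[0,p]$ with $(|S|-1)+(|T|-1)=p+i$. It defines a coproduct $\Delta^\Phi(\sigma)=\sum_{S,T}c^p_{S,T}\,\sigma|_S\otimes\sigma|_T$ on $C_\bullet(X)$. Its number of terms in dimension $p$ is the number of pairs $(S,T)$ with $c^p_{S,T}\ne0$. Call $\Phi$ *admissible for $X$* if $\Delta'=\Delta^\Phi$ satisfies $$\partial\circ\Delta'-(-1)^i\,\Delta'\circ\partial=(1+(-1)^iT)\,\Delta_{i-1}^\emptyset\quad\text{on } C_\bullet(X)$$ and, if $i=0$, also $\Delta'(\sigma)=\sigma\otimes\sigma$ for every singular $0$-simplex $\sigma$. **Theorem.** Suppose that $X$ has a path with two distinct end points. Let $\Delta'_i\colon C_\bullet(X)\to C_\bullet(X)\otimes C_\bullet(X)$ be a coproduct given by a dimension-only formula $\Phi$ of degree $i$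 that is admissible for $X$. Suppose that $\Phi$ has the minimal number of terms, i.e. in every dimension $p$ it has at most as many terms as any other dimension-only formula of degree $i$ admissible for $X$. Then $\Delta'_i=\Delta_i^\emptyset$ or $\Delta'_i=(-1)^i\,T\Delta_i^\emptyset$. -/

import Mathlib

open scoped TensorProduct

noncomputable section

namespace CupCoproduct

/-! ### Singular chains -/

/-- Singular `p`-simplices of `X`: continuous maps from the standard `p`-simplex to `X`. -/
abbrev SingularSimplex (X : Type*) [TopologicalSpace X] (p : ℕ) : Type _ :=
  C(stdSimplex ℝ (Fin (p + 1)), X)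

/-- The singular chains of `X`, as the direct sum over all degrees `p` of the free abelian groups
on the singular `p`-simplices. A basis element is a pair `⟨p, σ⟩`. -/
abbrev Chains (X : Type*) [TopologicalSpace X] : Type _ :=
  (Σ p : ℕ, SingularSimplex X p) →₀ ℤ

variable {X : Type*} [TopologicalSpace X]

/-- Instance selection only: the `ℤ`-module structures of `Chains X` and of its tensor square that
are to be found first (they agree with the structure that every abelian group has). -/
instance (priority := high) chainsModule : Module ℤ (Chains X) :=
  Finsupp.module _ ℤ

/-- See `chainsModule`. -/
instance (priority := high) tensorModule : Module ℤ (Chains X ⊗[ℤ] Chains X) :=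
  TensorProduct.instModule

/-- A singular simplex as a chain. -/
def simplexChain {p : ℕ} (σ : SingularSimplex X p) : Chains X :=
  Finsupp.single ⟨p, σ⟩ 1

/-- The order-preserving enumeration of a non-empty set of vertices. -/
def vertexMap {p : ℕ} (S : Finset (Fin (p + 1))) (hS : S.Nonempty) :
    Fin (S.card - 1 + 1) ↪o Fin (p + 1) :=
  S.orderEmbOfFin (Nat.sub_add_cancel hS.card_pos).symm

/-- The restriction of a singular simplex `σ` to the face of the standard simplex whose set of
vertices is the non-empty set `S`; it is a singular simplex of dimension `|S| - 1`. -/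
def face {p : ℕ} (σ : SingularSimplex X p) (S : Finset (Fin (p + 1))) (hS : S.Nonempty) :
    SingularSimplex X (S.card - 1) :=
  σ.comp ⟨stdSimplex.map (vertexMap S hS), stdSimplex.continuous_map _⟩

open Classical in
/-- The face of `σ` spanned by `S`, as a chain; the empty face is zero. -/
def faceChain {p : ℕ} (σ : SingularSimplex X p) (S : Finset (Fin (p + 1))) : Chains X :=
  if hS : S.Nonempty then simplexChain (face σ S hS) else 0

/-- The singular boundary map `∂ σ = ∑ j, (-1)^j σ|_{[0, p] \ j}`, which is zero on
`0`-simplices. -/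
def boundary (X : Type*) [TopologicalSpace X] : Chains X →ₗ[ℤ] Chains X :=
  Finsupp.linearCombination ℤ fun s =>
    ∑ j : Fin (s.1 + 1), (-1 : ℤ) ^ (j : ℕ) • faceChain s.2 (Finset.univ.erase j)

/-- The map `x ↦ (-1)^{|x|} x` on chains. -/
def degreeSign (X : Type*) [TopologicalSpace X] : Chains X →ₗ[ℤ] Chains X :=
  Finsupp.linearCombination ℤ fun s => (-1 : ℤ) ^ s.1 • simplexChain s.2

/-- The differential `∂ (x ⊗ y) = ∂ x ⊗ y + (-1)^{|x|} x ⊗ ∂ y`. -/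
def tensorBoundary (X : Type*) [TopologicalSpace X] :
    Chains X ⊗[ℤ] Chains X →ₗ[ℤ] Chains X ⊗[ℤ] Chains X :=
  TensorProduct.map (boundary X) LinearMap.id + TensorProduct.map (degreeSign X) (boundary X)

/-- The symmetry `T (x ⊗ y) = (-1)^{|x| |y|} y ⊗ x`. -/
def swap (X : Type*) [TopologicalSpace X] :
    Chains X ⊗[ℤ] Chains X →ₗ[ℤ] Chains X ⊗[ℤ] Chains X :=
  TensorProduct.lift <| Finsupp.linearCombination ℤ fun s =>
    Finsupp.linearCombination ℤ fun t =>
      (-1 : ℤ) ^ (s.1 * t.1) • (simplexChain t.2 ⊗ₜ[ℤ] simplexChain s.2)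

/-! ### The coproducts `Δ_i^∅` -/

/-- `|L_{>a}|`; the vertex `a` is an even or odd gap of `L` according to its parity. -/
def numAbove {p : ℕ} (L : Finset (Fin (p + 1))) (a : Fin (p + 1)) : ℕ :=
  (L.filter fun l => a < l).card

/-- `|L_{<a}|`. -/
def numBelow {p : ℕ} (L : Finset (Fin (p + 1))) (a : Fin (p + 1)) : ℕ :=
  (L.filter fun l => l < a).card

/-- The initial vertex `A_L^U` of the cube with generating vectors `L` in the cubillage of the
collection `U`: a vertex `a ∉ L` belongs to it iff `L ∪ {a} ∈ U` and `a` is an even gap of `L`, or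
`L ∪ {a} ∉ U` and `a` is an odd gap of `L`. -/
def initialVertex {p : ℕ} (U : Finset (Finset (Fin (p + 1)))) (L : Finset (Fin (p + 1))) :
    Finset (Fin (p + 1)) :=
  Finset.univ.filter fun a => a ∉ L ∧
    ((insert a L ∈ U ∧ Even (numAbove L a)) ∨ (insert a L ∉ U ∧ Odd (numAbove L a)))

/-- `B_L^U = [0, p] \ (L ∪ A_L^U)`. -/
def coInitialVertex {p : ℕ} (U : Finset (Finset (Fin (p + 1)))) (L : Finset (Fin (p + 1))) :
    Finset (Fin (p + 1)) :=
  (L ∪ initialVertex U L)ᶜ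

/-- The exponent `ε(L ∪ A ⊗ L ∪ B)` of the sign of a term. -/
def signExponent {p : ℕ} (L A B : Finset (Fin (p + 1))) : ℕ :=
  ∑ b ∈ B, numBelow A b + ∑ l ∈ L, numBelow L l + (p + 1) * A.card

/-- The value `Δ_i^U(σ) = ∑_{|L| = i + 1} (-1)^ε σ|_{L ∪ A_L^U} ⊗ σ|_{L ∪ B_L^U}`. -/
def cubillageValue (i : ℕ) {p : ℕ} (U : Finset (Finset (Fin (p + 1))))
    (σ : SingularSimplex X p) : Chains X ⊗[ℤ] Chains X :=
  ∑ L ∈ Finset.powersetCard (i + 1) (Finset.univ : Finset (Fin (p + 1))),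
    (-1 : ℤ) ^ signExponent L (initialVertex U L) (coInitialVertex U L) •
      (faceChain σ (L ∪ initialVertex U L) ⊗ₜ[ℤ] faceChain σ (L ∪ coInitialVertex U L))

/-- The coproduct `Δ_i^∅` on singular chains, for `i ≥ 0`. -/
def deltaEmpty (X : Type*) [TopologicalSpace X] (i : ℕ) :
    Chains X →ₗ[ℤ] Chains X ⊗[ℤ] Chains X :=
  Finsupp.linearCombination ℤ fun s => cubillageValue i ∅ s.2

/-- The coproduct `Δ_{i-1}^∅`, with the convention `Δ_{-1}^∅ = 0`. -/
def deltaEmptyPred (X : Type*) [TopologicalSpace X] :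
    ℕ → (Chains X →ₗ[ℤ] Chains X ⊗[ℤ] Chains X)
  | 0 => 0
  | i + 1 => deltaEmpty X i

/-! ### Coproducts given by a formula that depends only on the dimension -/

/-- A formula for a degree `i` coproduct that depends only on the dimension of the simplex: for
each dimension `p`, an integral combination of pairs of faces `S ⊗ T` of the standard `p`-simplex
with `(|S| - 1) + (|T| - 1) = p + i`. As `|S|, |T| ≤ p + 1`, both faces are then non-empty. -/
structure Formula (i : ℕ) where
  coeff : ∀ p : ℕ, Finset (Fin (p + 1)) → Finset (Fin (p + 1)) → ℤ
  degree : ∀ (p : ℕ) (S T : Finset (Fin (p + 1))), coeff p S T ≠ 0 → S.card + T.card = p + i + 2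

/-- The value of a formula on a singular simplex. -/
def Formula.value {i : ℕ} (Φ : Formula i) {p : ℕ} (σ : SingularSimplex X p) :
    Chains X ⊗[ℤ] Chains X :=
  ∑ S : Finset (Fin (p + 1)), ∑ T : Finset (Fin (p + 1)),
    Φ.coeff p S T • (faceChain σ S ⊗ₜ[ℤ] faceChain σ T)

/-- The coproduct on singular chains of `X` given by a formula. -/
def Formula.coproduct {i : ℕ} (Φ : Formula i) (X : Type*) [TopologicalSpace X] :
    Chains X →ₗ[ℤ] Chains X ⊗[ℤ] Chains X :=
  Finsupp.linearCombination ℤ fun s => Φ.value s.2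

/-- The number of terms of a formula in dimension `p`. -/
def Formula.numTerms {i : ℕ} (Φ : Formula i) (p : ℕ) : ℕ :=
  (Finset.univ.filter fun ST : Finset (Fin (p + 1)) × Finset (Fin (p + 1)) =>
    Φ.coeff p ST.1 ST.2 ≠ 0).card

/-- The homotopy formula `∂ ∘ D - (-1)^i D ∘ ∂ = (1 + (-1)^i T) Δ_{i-1}^∅`. -/
def HomotopyFormula (i : ℕ) (D : Chains X →ₗ[ℤ] Chains X ⊗[ℤ] Chains X) : Prop :=
  tensorBoundary X ∘ₗ D - (-1 : ℤ) ^ i • (D ∘ₗ boundary X) =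
    (LinearMap.id + (-1 : ℤ) ^ i • swap X) ∘ₗ deltaEmptyPred X i

/-- For `i = 0`, the coproduct sends each `0`-simplex `σ` to `σ ⊗ σ`; no condition otherwise. -/
def Normalized (i : ℕ) (D : Chains X →ₗ[ℤ] Chains X ⊗[ℤ] Chains X) : Prop :=
  i = 0 → ∀ σ : SingularSimplex X 0, D (simplexChain σ) = simplexChain σ ⊗ₜ[ℤ] simplexChain σ

end CupCoproduct

end

noncomputable section

namespace CupCoproduct

variable {X : Type*} [TopologicalSpace X]

/-! ### Signs and counting -/

/-! Existence. In the boundary of the term of `L`, a vertex outside `L` lies in only one factor;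
removing it leaves the term of the same `L` on a facet of the simplex, because the side (`A` or `B`)
of a vertex depends on `L` alone. These facets make up `(-1)^i Δ_i^∅ ∂`. A vertex `l ∈ L` can be
removed from either factor, which puts it on one side of `M = L \ l`. For fixed `M`, the two facets
in direction `l` are consecutive stations of a path that moves the vertices outside `M` to the other
side one by one in increasing order. The sum over `l` therefore telescopes to the term of `M` minus
its transpose, which is `(1 + (-1)^i T) Δ_{i-1}^∅` after summation over `M`
(`homotopyFormula_deltaEmpty`).

Lower bound. Two admissible formulas that agree in dimension `p - 1` differ in dimension `p` by a
cycle. This can be read off coefficientwise, since `X` has singular simplices on which a given pair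
of faces differs from all other pairs (`Formula.formalCycle_sub`). Modulo two, the coefficients of a
cycle over all pairs with `S ∪ T = [0, p]` and `S ∩ T = L ≠ ∅` sum to zero
(`FormalCycleModTwo.sum_eq_zero`). The formula of `Δ_i^∅` has exactly one such pair for each `L`
with `i + 1` elements, with coefficient `±1`. So its competitor has an odd coefficient over each
`L`, and if it is minimal, exactly one pair for each `L` and nothing else (`Tight.of_card_le`).

Rigidity. If all pairs in a cycle cover `[0, p]`, its support is stable under moving a vertex
outside `S ∩ T` to the other factor. For `p ≥ i + 2` a nonzero difference of two tight families
would thus contain three pairs with the same intersection, while each family supplies at most one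
(`Tight.eq_of_formalCycle`). For `p < i` there are no terms, and for `p = i` the single coefficient
is forced by the cycle condition or the normalization. The only freedom is in dimension `p = i + 1`,
where one vertex lies outside `L`; there a cycle vanishes everywhere or nowhere in its degree, which
leaves `Δ_i^∅` and its opposite (`Tight.eq_or_eq_of_formalCycle`). -/

theorem neg_one_pow_eq_of_mod {a b : ℕ} (h : a % 2 = b % 2) : (-1 : ℤ) ^ a = (-1 : ℤ) ^ b := by
  apply neg_one_pow_congr
  rw [Nat.even_iff, Nat.even_iff, h]

theorem numBelow_map {p q : ℕ} (e : Fin (q + 1) ↪o Fin (p + 1)) (L : Finset (Fin (q + 1)))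
    (a : Fin (q + 1)) : numBelow (L.map e.toEmbedding) (e a) = numBelow L a := by
  simp [numBelow, Finset.filter_map]

theorem numAbove_map {p q : ℕ} (e : Fin (q + 1) ↪o Fin (p + 1)) (L : Finset (Fin (q + 1)))
    (a : Fin (q + 1)) : numAbove (L.map e.toEmbedding) (e a) = numAbove L a := by
  simp [numAbove, Finset.filter_map]

theorem numBelow_univ {p : ℕ} (a : Fin (p + 1)) : numBelow Finset.univ a = a := by
  rw [numBelow, ← Fin.card_Iio a]
  congr 1
  ext
  simp

theorem numBelow_insert {p : ℕ} {L : Finset (Fin (p + 1))} {l : Fin (p + 1)} (hl : l ∉ L)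
    (a : Fin (p + 1)) : numBelow (insert l L) a = numBelow L a + if l < a then 1 else 0 := by
  unfold numBelow
  rw [Finset.filter_insert]
  split_ifs
  · rw [Finset.card_insert_of_notMem (by simp [hl])]
  · simp

theorem numBelow_insert_self {p : ℕ} (L : Finset (Fin (p + 1))) (a : Fin (p + 1)) :
    numBelow (insert a L) a = numBelow L a := by
  simp [numBelow, Finset.filter_insert]

theorem numBelow_union {p : ℕ} {L M : Finset (Fin (p + 1))} (h : Disjoint L M)
    (a : Fin (p + 1)) : numBelow (L ∪ M) a = numBelow L a + numBelow M a := by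
  unfold numBelow
  rw [Finset.filter_union, Finset.card_union_of_disjoint]
  exact Finset.disjoint_filter_filter h

theorem numBelow_add_numAbove {p : ℕ} {L : Finset (Fin (p + 1))} {a : Fin (p + 1)} (ha : a ∉ L) :
    numBelow L a + numAbove L a = L.card := by
  unfold numBelow numAbove
  rw [← Finset.card_union_of_disjoint]
  · congr 1
    ext x
    simp only [Finset.mem_union, Finset.mem_filter]
    constructor
    · tauto
    · intro hx
      rcases lt_trichotomy x a with h | h | h
      · tauto
      · subst h; tauto
      · tauto
  · rw [Finset.disjoint_left]
    intro x hx hx'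
    simp only [Finset.mem_filter] at hx hx'
    exact absurd (hx.2.trans hx'.2) (lt_irrefl _)

theorem sum_lt_eq_numAbove {p : ℕ} (B : Finset (Fin (p + 1))) (a : Fin (p + 1)) :
    ∑ b ∈ B, (if a < b then 1 else 0) = numAbove B a := by
  simp [numAbove]

theorem numBelow_vertexMap {p : ℕ} (S : Finset (Fin (p + 1))) (hS : S.Nonempty)
    (j : Fin (S.card - 1 + 1)) : numBelow S (vertexMap S hS j) = j := by
  have h : S = (Finset.univ : Finset (Fin (S.card - 1 + 1))).map (vertexMap S hS).toEmbedding := by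
    simp [vertexMap, Finset.map_orderEmbOfFin_univ]
  calc numBelow S (vertexMap S hS j)
      = numBelow (Finset.univ.map (vertexMap S hS).toEmbedding) (vertexMap S hS j) :=
        congrArg (fun R => numBelow R (vertexMap S hS j)) h
    _ = j := by rw [numBelow_map, numBelow_univ]

/-! ### Faces -/

theorem map_vertexMap_univ {p : ℕ} (S : Finset (Fin (p + 1))) (hS : S.Nonempty) :
    (Finset.univ : Finset (Fin (S.card - 1 + 1))).map (vertexMap S hS).toEmbedding = S := by
  simp [vertexMap, Finset.map_orderEmbOfFin_univ]

@[simp] theorem faceChain_empty {p : ℕ} (σ : SingularSimplex X p) : faceChain σ ∅ = 0 := by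
  simp [faceChain]

theorem faceChain_of_nonempty {p : ℕ} (σ : SingularSimplex X p) {S : Finset (Fin (p + 1))}
    (hS : S.Nonempty) : faceChain σ S = simplexChain (face σ S hS) := by
  simp [faceChain, hS]

/-- A face may be computed from any order embedding onto its set of vertices. -/
theorem faceChain_eq_of_orderEmbedding {p k : ℕ} (σ : SingularSimplex X p)
    (S : Finset (Fin (p + 1))) (e : Fin (k + 1) ↪o Fin (p + 1))
    (he : Finset.univ.map e.toEmbedding = S) :
    faceChain σ S =
      simplexChain (σ.comp ⟨stdSimplex.map e, stdSimplex.continuous_map _⟩) := by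
  have hcard : S.card = k + 1 := by rw [← he]; simp
  have hS : S.Nonempty := Finset.card_pos.mp (by omega)
  obtain rfl : k = S.card - 1 := by omega
  rw [faceChain_of_nonempty σ hS]
  have : e = vertexMap S hS := by
    apply Finset.orderEmbOfFin_unique'
    intro x
    have := Finset.mem_map_of_mem e.toEmbedding (Finset.mem_univ x)
    rwa [he] at this
  subst this
  rfl

theorem faceChain_face {p : ℕ} (σ : SingularSimplex X p) (V : Finset (Fin (p + 1)))
    (hV : V.Nonempty) (U : Finset (Fin (V.card - 1 + 1))) :
    faceChain (face σ V hV) U = faceChain σ (U.map (vertexMap V hV).toEmbedding) := by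
  rcases U.eq_empty_or_nonempty with rfl | hU
  · simp
  · rw [faceChain_of_nonempty _ hU, faceChain_eq_of_orderEmbedding σ _
      ((vertexMap U hU).trans (vertexMap V hV))]
    · congr 1
      ext x
      simp only [face, ContinuousMap.comp_apply, ContinuousMap.coe_mk]
      rw [stdSimplex.map_comp_apply]
      rfl
    · conv_rhs => rw [← map_vertexMap_univ U hU]
      rw [Finset.map_map]
      rfl

theorem faceChain_univ {p : ℕ} (σ : SingularSimplex X p) :
    faceChain σ Finset.univ = simplexChain σ := by
  rw [faceChain_eq_of_orderEmbedding σ _ (OrderIso.refl (Fin (p + 1))).toOrderEmbedding]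
  · congr 1
    ext x
    simp
  · ext x; simp

theorem linearCombination_simplexChain {M : Type*} [AddCommMonoid M] [Module ℤ M]
    (f : (Σ p : ℕ, SingularSimplex X p) → M) {p : ℕ} (σ : SingularSimplex X p) :
    Finsupp.linearCombination ℤ f (simplexChain σ) = f ⟨p, σ⟩ := by
  rw [simplexChain, Finsupp.linearCombination_single, one_smul]

theorem boundary_simplexChain {p : ℕ} (σ : SingularSimplex X p) :
    boundary X (simplexChain σ) =
      ∑ j : Fin (p + 1), (-1 : ℤ) ^ (j : ℕ) • faceChain σ (Finset.univ.erase j) :=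
  linearCombination_simplexChain _ σ

theorem boundary_faceChain {p : ℕ} (σ : SingularSimplex X p) (S : Finset (Fin (p + 1))) :
    boundary X (faceChain σ S) =
      ∑ s ∈ S, (-1 : ℤ) ^ numBelow S s • faceChain σ (S.erase s) := by
  rcases S.eq_empty_or_nonempty with rfl | hS
  · simp
  · rw [faceChain_of_nonempty σ hS, boundary_simplexChain]
    conv_rhs => rw [← map_vertexMap_univ S hS]
    rw [Finset.sum_map]
    refine Finset.sum_congr rfl fun j _ => ?_
    rw [faceChain_face, Finset.map_erase, map_vertexMap_univ]
    congr 2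
    exact (numBelow_vertexMap S hS j).symm

theorem degreeSign_faceChain {p : ℕ} (σ : SingularSimplex X p) (S : Finset (Fin (p + 1))) :
    degreeSign X (faceChain σ S) = (-1 : ℤ) ^ (S.card - 1) • faceChain σ S := by
  rcases S.eq_empty_or_nonempty with rfl | hS
  · simp
  · rw [faceChain_of_nonempty σ hS]
    exact linearCombination_simplexChain _ _

theorem swap_faceChain {p : ℕ} (σ : SingularSimplex X p) (S T : Finset (Fin (p + 1))) :
    swap X (faceChain σ S ⊗ₜ[ℤ] faceChain σ T) =
      (-1 : ℤ) ^ ((S.card - 1) * (T.card - 1)) • (faceChain σ T ⊗ₜ[ℤ] faceChain σ S) := by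
  rcases S.eq_empty_or_nonempty with rfl | hS
  · simp
  rcases T.eq_empty_or_nonempty with rfl | hT
  · simp
  rw [faceChain_of_nonempty σ hS, faceChain_of_nonempty σ hT, swap, TensorProduct.lift.tmul,
    linearCombination_simplexChain, linearCombination_simplexChain]

theorem tensorBoundary_faceChain {p : ℕ} (σ : SingularSimplex X p) (S T : Finset (Fin (p + 1))) :
    tensorBoundary X (faceChain σ S ⊗ₜ[ℤ] faceChain σ T) =
      ∑ s ∈ S, (-1 : ℤ) ^ numBelow S s • (faceChain σ (S.erase s) ⊗ₜ[ℤ] faceChain σ T) +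
      ∑ t ∈ T, (-1 : ℤ) ^ (S.card - 1 + numBelow T t) •
        (faceChain σ S ⊗ₜ[ℤ] faceChain σ (T.erase t)) := by
  rw [tensorBoundary, LinearMap.add_apply, TensorProduct.map_tmul, TensorProduct.map_tmul,
    boundary_faceChain, boundary_faceChain, degreeSign_faceChain, TensorProduct.sum_tmul,
    TensorProduct.tmul_sum]
  congr 1
  refine Finset.sum_congr rfl fun t _ => ?_
  rw [TensorProduct.smul_tmul_smul, pow_add]

theorem chains_hom_ext {M : Type*} [AddCommMonoid M] [Module ℤ M] {f g : Chains X →ₗ[ℤ] M}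
    (h : ∀ (p : ℕ) (σ : SingularSimplex X p), f (simplexChain σ) = g (simplexChain σ)) :
    f = g := by
  refine Finsupp.lhom_ext' fun s => ?_
  ext
  exact h s.1 s.2

/-! ### The sign exponents -/

/-- The sign exponent of a term supported on a face with `n` vertices. -/
def relSignExponent {p : ℕ} (n : ℕ) (L A B : Finset (Fin (p + 1))) : ℕ :=
  ∑ b ∈ B, numBelow A b + ∑ l ∈ L, numBelow L l + n * A.card

theorem sum_numBelow_insert {p : ℕ} {A : Finset (Fin (p + 1))} {l : Fin (p + 1)} (hl : l ∉ A)
    (B : Finset (Fin (p + 1))) :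
    ∑ b ∈ B, numBelow (insert l A) b = ∑ b ∈ B, numBelow A b + numAbove B l := by
  rw [← sum_lt_eq_numAbove, ← Finset.sum_add_distrib]
  exact Finset.sum_congr rfl fun b _ => numBelow_insert hl b

theorem sum_numBelow_insert_self {p : ℕ} {M : Finset (Fin (p + 1))} {l : Fin (p + 1)}
    (hl : l ∉ M) :
    ∑ b ∈ insert l M, numBelow (insert l M) b = ∑ b ∈ M, numBelow M b + M.card := by
  rw [Finset.sum_insert hl, sum_numBelow_insert hl, numBelow_insert_self,
    ← numBelow_add_numAbove hl]
  ring

theorem card_of_partition {p : ℕ} {L A B : Finset (Fin (p + 1))} (hLA : Disjoint L A)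
    (hB : B = (L ∪ A)ᶜ) : L.card + A.card + B.card = p + 1 := by
  have := Finset.card_add_card_compl (L ∪ A)
  rw [Finset.card_union_of_disjoint hLA, ← hB, Fintype.card_fin] at this
  exact this

theorem numBelow_of_partition {p : ℕ} {L A B : Finset (Fin (p + 1))} (hLA : Disjoint L A)
    (hB : B = (L ∪ A)ᶜ) (j : Fin (p + 1)) :
    numBelow L j + numBelow A j + numBelow B j = j := by
  rw [← numBelow_union hLA, ← numBelow_union, hB, Finset.union_compl, numBelow_univ]
  rw [hB]
  exact disjoint_compl_right

/-- For `|L| = i + 1` the factor `L.card + 1 + j` gives the sign `(-1)^(i + j)` with which the facet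
opposite `j` enters `(-1)^i Δ_i^∅ ∂`. The counts below `j` in `L`, `A` and `B` add up to `j`. -/
theorem signExponent_erase_left {p : ℕ} {L A B : Finset (Fin (p + 1))} (hLA : Disjoint L A)
    (hB : B = (L ∪ A)ᶜ) {j : Fin (p + 1)} (hj : j ∈ A) :
    (signExponent L A B + numBelow (L ∪ A) j) % 2 =
      (L.card + 1 + j + relSignExponent p L (A.erase j) B) % 2 := by
  have hcard := card_of_partition hLA hB
  have hbel := numBelow_of_partition hLA hB j
  have hjB : j ∉ B := by rw [hB]; simp [hj]
  obtain ⟨A', hjA', rfl⟩ : ∃ A', j ∉ A' ∧ insert j A' = A :=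
    ⟨A.erase j, Finset.notMem_erase j A, Finset.insert_erase hj⟩
  have h := numBelow_add_numAbove hjB
  rw [numBelow_union hLA, Finset.erase_insert hjA', relSignExponent, signExponent,
    sum_numBelow_insert hjA', numBelow_insert_self]
  rw [numBelow_insert_self] at hbel
  rw [Finset.card_insert_of_notMem hjA'] at hcard ⊢
  have e1 : (p + 1) * (A'.card + 1) = p * A'.card + p + A'.card + 1 := by ring
  rw [e1]
  omega

theorem signExponent_erase_right {p : ℕ} {L A B : Finset (Fin (p + 1))} (hLA : Disjoint L A)
    (hB : B = (L ∪ A)ᶜ) (hL : L.Nonempty) {j : Fin (p + 1)} (hj : j ∈ B) :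
    (signExponent L A B + ((L ∪ A).card - 1 + numBelow (L ∪ B) j)) % 2 =
      (L.card + 1 + j + relSignExponent p L A (B.erase j)) % 2 := by
  have hbel := numBelow_of_partition hLA hB j
  have hLB : Disjoint L B := by
    rw [hB]
    exact disjoint_compl_right.mono_left Finset.subset_union_left
  have hL' := hL.card_pos
  have h := Finset.add_sum_erase B (fun b => numBelow A b) hj
  rw [numBelow_union hLB, Finset.card_union_of_disjoint hLA, relSignExponent, signExponent, ← h]
  have e1 : (p + 1) * A.card = p * A.card + A.card := by ring
  rw [e1]
  omega

/-- Removing `l` from the first factor makes it a vertex of the `B`-side of `M`; in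
`signExponent_facet_right` it joins the `A`-side. The two signs relative to the terms of `M` are
opposite, as telescoping requires. -/
theorem signExponent_facet_left {p : ℕ} {M A B : Finset (Fin (p + 1))} {l : Fin (p + 1)}
    (hl : l ∉ M) (hLA : Disjoint (insert l M) A) (hB : B = (insert l M ∪ A)ᶜ) :
    (signExponent (insert l M) A B + numBelow (insert l M ∪ A) l) % 2 =
      (M.card + numBelow M l + signExponent M A (insert l B)) % 2 := by
  have hlB : l ∉ B := by rw [hB]; simp
  rw [numBelow_union hLA, signExponent, signExponent, Finset.sum_insert hlB,
    sum_numBelow_insert_self hl, numBelow_insert_self]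
  omega

theorem signExponent_facet_right {p : ℕ} {M A B : Finset (Fin (p + 1))} {l : Fin (p + 1)}
    (hl : l ∉ M) (hLA : Disjoint (insert l M) A) (hB : B = (insert l M ∪ A)ᶜ) :
    (signExponent (insert l M) A B +
        ((insert l M ∪ A).card - 1 + numBelow (insert l M ∪ B) l)) % 2 =
      (M.card + 1 + numBelow M l + signExponent M (insert l A) B) % 2 := by
  have hlB : l ∉ B := by rw [hB]; simp
  have hlA : l ∉ A := Finset.disjoint_left.mp hLA (Finset.mem_insert_self _ _)
  have hcard := card_of_partition hLA hB
  have hLB : Disjoint (insert l M) B := by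
    rw [hB]
    exact disjoint_compl_right.mono_left Finset.subset_union_left
  have h := numBelow_add_numAbove hlB
  rw [numBelow_union hLB, Finset.card_union_of_disjoint hLA, signExponent, signExponent,
    sum_numBelow_insert_self hl, numBelow_insert_self, sum_numBelow_insert hlA]
  rw [Finset.card_insert_of_notMem hl] at hcard ⊢
  rw [Finset.card_insert_of_notMem hlA]
  have e1 : (p + 1) * (A.card + 1) = (p + 1) * A.card + p + 1 := by ring
  rw [e1]
  omega

/-- Every pair in `A × B` is counted once, according to which of its members is smaller. -/
theorem sum_numBelow_add_sum_numBelow {p : ℕ} {A B : Finset (Fin (p + 1))} (h : Disjoint A B) :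
    ∑ b ∈ B, numBelow A b + ∑ a ∈ A, numBelow B a = A.card * B.card := by
  have h1 : ∑ a ∈ A, numBelow B a = ∑ b ∈ B, numAbove A b := by
    simp only [numBelow, numAbove, Finset.card_filter]
    exact Finset.sum_comm
  rw [h1, ← Finset.sum_add_distrib, Finset.sum_congr rfl fun b hb =>
    numBelow_add_numAbove (Finset.disjoint_right.mp h hb)]
  simp [mul_comm]

/-- Exchanging the two factors of a term changes its sign exponent by the degree of the
transposition, up to `|M| - 1`. -/
theorem signExponent_swap {p : ℕ} {M A B : Finset (Fin (p + 1))} (hMA : Disjoint M A)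
    (hB : B = (M ∪ A)ᶜ) (hM : M.Nonempty) :
    (signExponent M B A + 1) % 2 =
      (M.card + (signExponent M A B + ((M ∪ A).card - 1) * ((M ∪ B).card - 1))) % 2 := by
  have hcard := card_of_partition hMA hB
  have hMB : Disjoint M B := by
    rw [hB]
    exact disjoint_compl_right.mono_left Finset.subset_union_left
  have hAB : Disjoint A B := by
    rw [hB]
    exact disjoint_compl_right.mono_left Finset.subset_union_right
  have h := sum_numBelow_add_sum_numBelow hAB
  obtain ⟨m, hm⟩ : ∃ m, M.card = m + 1 := ⟨M.card - 1, by have := hM.card_pos; omega⟩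
  rw [Finset.card_union_of_disjoint hMA, Finset.card_union_of_disjoint hMB, signExponent,
    signExponent, hm]
  rw [hm] at hcard
  have hp : p + 1 = m + A.card + B.card + 1 := by omega
  rw [show m + 1 + A.card - 1 = m + A.card by omega, show m + 1 + B.card - 1 = m + B.card by omega]
  generalize A.card = a at *
  generalize B.card = b at *
  have hs : ∑ a ∈ A, numBelow B a = a * b - ∑ b ∈ B, numBelow A b := by omega
  have hle : ∑ b ∈ B, numBelow A b ≤ a * b := by omega
  rw [hs]
  generalize ∑ b ∈ B, numBelow A b = x at *
  generalize ∑ l ∈ M, numBelow M l = y at *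
  -- `w` counts the pairs in the other order. With `a * b = x + w` and squares congruent to their
  -- roots, the parity claim becomes linear in the remaining products.
  obtain ⟨w, hw⟩ := Nat.exists_eq_add_of_le hle
  rw [hw, Nat.add_sub_cancel_left]
  have e1 : (p + 1) * b = m * b + (x + w) + b * b + b := by rw [← hw, hp]; ring
  have e2 : (p + 1) * a = m * a + (x + w) + a * a + a := by rw [← hw, hp]; ring
  have e3 : (m + a) * (m + b) = m * m + m * b + m * a + (x + w) := by rw [← hw]; ring
  rw [e1, e2, e3]
  have sq : ∀ n : ℕ, (n * n) % 2 = n % 2 := fun n => by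
    rcases Nat.mod_two_eq_zero_or_one n with h | h <;> simp [Nat.mul_mod, h]
  have := sq a
  have := sq b
  have := sq m
  omega

/-! ### The value of `Δ_i^∅` on a face -/

theorem mem_initialVertex_empty {p : ℕ} {L : Finset (Fin (p + 1))} {a : Fin (p + 1)} :
    a ∈ initialVertex ∅ L ↔ a ∉ L ∧ Odd (numAbove L a) := by
  simp [initialVertex]

theorem mem_coInitialVertex_empty {p : ℕ} {L : Finset (Fin (p + 1))} {a : Fin (p + 1)} :
    a ∈ coInitialVertex ∅ L ↔ a ∉ L ∧ ¬ Odd (numAbove L a) := by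
  simp only [coInitialVertex, Finset.mem_compl, Finset.mem_union, mem_initialVertex_empty]
  tauto

theorem disjoint_initialVertex {p : ℕ} (L : Finset (Fin (p + 1))) :
    Disjoint L (initialVertex ∅ L) := by
  rw [Finset.disjoint_left]
  intro a ha h
  exact (mem_initialVertex_empty.mp h).1 ha

/-- The side of a vertex depends only on the elements of `L` above it, not on the ambient simplex.
-/
theorem initialVertex_map {p q : ℕ} (e : Fin (q + 1) ↪o Fin (p + 1)) (L : Finset (Fin (q + 1))) :
    (initialVertex ∅ L).map e.toEmbedding =
      initialVertex ∅ (L.map e.toEmbedding) ∩ Finset.univ.map e.toEmbedding := by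
  ext a
  simp only [Finset.mem_inter, Finset.mem_map, mem_initialVertex_empty, Finset.mem_univ, true_and]
  constructor
  · rintro ⟨x, ⟨hx, hx'⟩, rfl⟩
    refine ⟨⟨?_, ?_⟩, x, rfl⟩
    · rintro ⟨y, hy, hyx⟩
      exact hx (e.injective hyx ▸ hy)
    · exact (numAbove_map e L x).symm ▸ hx'
  · rintro ⟨⟨h, h'⟩, x, rfl⟩
    exact ⟨x, ⟨fun hx => h ⟨x, hx, rfl⟩, numAbove_map e L x ▸ h'⟩, rfl⟩

theorem coInitialVertex_map {p q : ℕ} (e : Fin (q + 1) ↪o Fin (p + 1))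
    (L : Finset (Fin (q + 1))) :
    (coInitialVertex ∅ L).map e.toEmbedding =
      coInitialVertex ∅ (L.map e.toEmbedding) ∩ Finset.univ.map e.toEmbedding := by
  ext a
  simp only [Finset.mem_inter, Finset.mem_map, mem_coInitialVertex_empty, Finset.mem_univ,
    true_and]
  constructor
  · rintro ⟨x, ⟨hx, hx'⟩, rfl⟩
    refine ⟨⟨?_, ?_⟩, x, rfl⟩
    · rintro ⟨y, hy, hyx⟩
      exact hx (e.injective hyx ▸ hy)
    · exact (numAbove_map e L x).symm ▸ hx'
  · rintro ⟨⟨h, h'⟩, x, rfl⟩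
    exact ⟨x, ⟨fun hx => h ⟨x, hx, rfl⟩, numAbove_map e L x ▸ h'⟩, rfl⟩

theorem signExponent_map {p q n : ℕ} (hn : q + 1 = n) (e : Fin (q + 1) ↪o Fin (p + 1))
    (L A B : Finset (Fin (q + 1))) :
    signExponent L A B = relSignExponent n (L.map e.toEmbedding) (A.map e.toEmbedding)
      (B.map e.toEmbedding) := by
  have h (C : Finset (Fin (q + 1))) (a : Fin (q + 1)) :
      numBelow (C.map e.toEmbedding) (e.toEmbedding a) = numBelow C a := numBelow_map e C a
  subst hn
  simp only [signExponent, relSignExponent, Finset.sum_map, Finset.card_map, h]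

theorem deltaEmpty_simplexChain (i : ℕ) {p : ℕ} (σ : SingularSimplex X p) :
    deltaEmpty X i (simplexChain σ) = cubillageValue i ∅ σ :=
  linearCombination_simplexChain _ σ

/-- Since sides are intrinsic to `L`, passing to the face `V` only intersects both sides with `V`.
In the sign, `V.card` takes the place of `p + 1`. -/
theorem deltaEmpty_faceChain (i : ℕ) {p : ℕ} (σ : SingularSimplex X p)
    (V : Finset (Fin (p + 1))) :
    deltaEmpty X i (faceChain σ V) =
      ∑ L ∈ Finset.powersetCard (i + 1) V,
        (-1 : ℤ) ^ relSignExponent V.card L (initialVertex ∅ L ∩ V) (coInitialVertex ∅ L ∩ V) •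
          (faceChain σ (L ∪ initialVertex ∅ L ∩ V) ⊗ₜ[ℤ]
            faceChain σ (L ∪ coInitialVertex ∅ L ∩ V)) := by
  rcases V.eq_empty_or_nonempty with rfl | hV
  · have : Finset.powersetCard (i + 1) (∅ : Finset (Fin (p + 1))) = ∅ :=
      Finset.powersetCard_eq_empty.mpr (by simp)
    rw [this]
    simp
  · rw [faceChain_of_nonempty σ hV, deltaEmpty_simplexChain, cubillageValue]
    have hset : Finset.powersetCard (i + 1) V =
        (Finset.powersetCard (i + 1) (Finset.univ : Finset (Fin (V.card - 1 + 1)))).map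
          (Finset.mapEmbedding (vertexMap V hV).toEmbedding).toEmbedding := by
      rw [← Finset.powersetCard_map, map_vertexMap_univ]
    rw [hset, Finset.sum_map]
    refine Finset.sum_congr rfl fun L _ => ?_
    have hc : V.card - 1 + 1 = V.card := Nat.sub_add_cancel hV.card_pos
    have hA := initialVertex_map (vertexMap V hV) L
    have hB := coInitialVertex_map (vertexMap V hV) L
    rw [map_vertexMap_univ] at hA hB
    have hm : (Finset.mapEmbedding (vertexMap V hV).toEmbedding).toEmbedding L =
        L.map (vertexMap V hV).toEmbedding := rfl
    rw [faceChain_face, faceChain_face, Finset.map_union, Finset.map_union, hA, hB, hm,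
      signExponent_map hc (vertexMap V hV), hA, hB]

/-! ### The homotopy formula for `Δ_i^∅` -/

theorem neg_one_smul_tensor (x : Chains X ⊗[ℤ] Chains X) : (-1 : ℤ) • x = -x := by
  exact neg_one_smul ℤ x

theorem neg_smul_tensor (n : ℤ) (x : Chains X ⊗[ℤ] Chains X) : (-n) • x = -(n • x) := by
  exact neg_smul n x

/-- The tensor product of two faces of a simplex. -/
def facePair {p : ℕ} (σ : SingularSimplex X p) (S T : Finset (Fin (p + 1))) :
    Chains X ⊗[ℤ] Chains X :=
  faceChain σ S ⊗ₜ[ℤ] faceChain σ T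

@[simp] theorem facePair_empty_left {p : ℕ} (σ : SingularSimplex X p) (T : Finset (Fin (p + 1))) :
    facePair σ ∅ T = 0 := by simp [facePair]

@[simp] theorem facePair_empty_right {p : ℕ} (σ : SingularSimplex X p)
    (S : Finset (Fin (p + 1))) : facePair σ S ∅ = 0 := by simp [facePair]

/-- The signed term of a coproduct with given `L`, `A` and `B`. -/
def signedTerm {p : ℕ} (σ : SingularSimplex X p) (L A B : Finset (Fin (p + 1))) :
    Chains X ⊗[ℤ] Chains X :=
  (-1 : ℤ) ^ signExponent L A B • facePair σ (L ∪ A) (L ∪ B)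

/-- The vertices outside `M` on the `A`-side after the sides of all `a < k` have been exchanged. -/
def mixedVertex {p : ℕ} (M : Finset (Fin (p + 1))) (k : ℕ) : Finset (Fin (p + 1)) :=
  Finset.univ.filter fun a => a ∉ M ∧ Xor (Odd (numAbove M a)) ((a : ℕ) < k)

theorem mem_mixedVertex {p : ℕ} {M : Finset (Fin (p + 1))} {k : ℕ} {a : Fin (p + 1)} :
    a ∈ mixedVertex M k ↔ a ∉ M ∧ Xor (Odd (numAbove M a)) ((a : ℕ) < k) := by
  simp [mixedVertex]

/-- The complement of `mixedVertex M k` in the complement of `M`. -/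
def coMixedVertex {p : ℕ} (M : Finset (Fin (p + 1))) (k : ℕ) : Finset (Fin (p + 1)) :=
  (M ∪ mixedVertex M k)ᶜ

theorem mem_coMixedVertex {p : ℕ} {M : Finset (Fin (p + 1))} {k : ℕ} {a : Fin (p + 1)} :
    a ∈ coMixedVertex M k ↔ a ∉ M ∧ ¬ Xor (Odd (numAbove M a)) ((a : ℕ) < k) := by
  simp only [coMixedVertex, Finset.mem_compl, Finset.mem_union, mem_mixedVertex]
  tauto

theorem mixedVertex_zero {p : ℕ} (M : Finset (Fin (p + 1))) :
    mixedVertex M 0 = initialVertex ∅ M := by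
  ext a
  simp [mem_mixedVertex, mem_initialVertex_empty, Xor]

theorem coMixedVertex_zero {p : ℕ} (M : Finset (Fin (p + 1))) :
    coMixedVertex M 0 = coInitialVertex ∅ M := by
  rw [coMixedVertex, mixedVertex_zero, coInitialVertex]

theorem mixedVertex_last {p : ℕ} (M : Finset (Fin (p + 1))) :
    mixedVertex M (p + 1) = coInitialVertex ∅ M := by
  ext a
  simp [mem_mixedVertex, mem_coInitialVertex_empty, Xor, a.is_lt]

theorem coMixedVertex_last {p : ℕ} (M : Finset (Fin (p + 1))) :
    coMixedVertex M (p + 1) = initialVertex ∅ M := by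
  ext a
  simp [mem_coMixedVertex, mem_initialVertex_empty, Xor, a.is_lt]

theorem numAbove_insert {p : ℕ} {L : Finset (Fin (p + 1))} {l : Fin (p + 1)} (hl : l ∉ L)
    (a : Fin (p + 1)) : numAbove (insert l L) a = numAbove L a + if a < l then 1 else 0 := by
  unfold numAbove
  rw [Finset.filter_insert]
  split_ifs
  · rw [Finset.card_insert_of_notMem (by simp [hl])]
  · simp

/-- The source of the telescoping: enlarging `L` by `l` exchanges the sides of exactly the vertices
below `l`. -/
theorem odd_numAbove_insert {p : ℕ} {L : Finset (Fin (p + 1))} {l : Fin (p + 1)} (hl : l ∉ L)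
    (a : Fin (p + 1)) :
    Odd (numAbove (insert l L) a) ↔ Xor (Odd (numAbove L a)) (a < l) := by
  rw [numAbove_insert hl]
  split_ifs with h
  · simp [h, Xor, Nat.odd_add_one]
  · simp [h, Xor]

/-- The facets of the term of `insert l M` in the direction `l`. -/
theorem facets_eq_sub {p : ℕ} (σ : SingularSimplex X p) {M : Finset (Fin (p + 1))}
    {l : Fin (p + 1)} (hl : l ∉ M) (A B : Finset (Fin (p + 1)))
    (hA : A = initialVertex ∅ (insert l M)) (hB : B = coInitialVertex ∅ (insert l M)) :
    (-1 : ℤ) ^ (signExponent (insert l M) A B + numBelow (insert l M ∪ A) l) •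
        facePair σ ((insert l M ∪ A).erase l) (insert l M ∪ B) +
      (-1 : ℤ) ^ (signExponent (insert l M) A B +
          ((insert l M ∪ A).card - 1 + numBelow (insert l M ∪ B) l)) •
        facePair σ (insert l M ∪ A) ((insert l M ∪ B).erase l) =
    signedTerm σ M (mixedVertex M l) (coMixedVertex M l) -
      signedTerm σ M (mixedVertex M (l + 1)) (coMixedVertex M (l + 1)) := by
  have hdis : Disjoint (insert l M) A := hA ▸ disjoint_initialVertex _
  have hcompl : B = (insert l M ∪ A)ᶜ := by rw [hB, hA, coInitialVertex]
  have memA : ∀ a, a ∈ A ↔ a ≠ l ∧ a ∉ M ∧ Xor (Odd (numAbove M a)) (a < l) := fun a => by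
    rw [hA, mem_initialVertex_empty, odd_numAbove_insert hl]
    simp only [Finset.mem_insert]
    tauto
  have memB : ∀ a, a ∈ B ↔ a ≠ l ∧ a ∉ M ∧ ¬ Xor (Odd (numAbove M a)) (a < l) := fun a => by
    rw [hB, mem_coInitialVertex_empty, odd_numAbove_insert hl]
    simp only [Finset.mem_insert]
    tauto
  have e1 : (insert l M ∪ A).erase l = M ∪ A := by
    rw [Finset.insert_union, Finset.erase_insert]
    simp [hl, memA]
  have e2 : (insert l M ∪ B).erase l = M ∪ B := by
    rw [Finset.insert_union, Finset.erase_insert]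
    simp [hl, memB]
  have e3 : insert l M ∪ A = M ∪ insert l A := by ext; simp
  have e4 : insert l M ∪ B = M ∪ insert l B := by ext; simp
  have s1 := signExponent_facet_left hl hdis hcompl
  have s2 := signExponent_facet_right hl hdis hcompl
  have hn := numBelow_add_numAbove hl
  rw [e1, e2, neg_one_pow_eq_of_mod s1, neg_one_pow_eq_of_mod s2, e3, e4, pow_add, mul_smul,
    pow_add _ _ (signExponent M (insert l A) B), mul_smul]
  have lt_succ : ∀ a : Fin (p + 1), a ≠ l → ((a : ℕ) < l + 1 ↔ a < l) := fun a ha => by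
    rw [Fin.lt_def]
    have : (a : ℕ) ≠ l := fun h => ha (Fin.ext h)
    omega
  -- `M.card + numBelow M l` has the parity of `numAbove M l`. In an odd gap `l` starts on the
  -- `A`-side, so the second facet is the station `l` of the path and the first one the station `l +
  -- 1`; in an even gap it is the reverse. In both cases station `l` gets the sign `+`.
  by_cases ho : Odd (numAbove M l)
  · have a1 : mixedVertex M l = insert l A := by
      ext a
      by_cases ha : a = l
      · subst ha; simp [mem_mixedVertex, hl, ho, Xor]
      · simp [mem_mixedVertex, memA, ha]
    have b1 : coMixedVertex M l = B := by
      ext a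
      by_cases ha : a = l
      · subst ha; simp [mem_coMixedVertex, memB, ho, Xor]
      · simp [mem_coMixedVertex, memB, ha]
    have a2 : mixedVertex M (l + 1) = A := by
      ext a
      by_cases ha : a = l
      · subst ha; simp [mem_mixedVertex, memA, ho, Xor]
      · simp [mem_mixedVertex, memA, ha, lt_succ]
    have b2 : coMixedVertex M (l + 1) = insert l B := by
      ext a
      by_cases ha : a = l
      · subst ha; simp [mem_coMixedVertex, hl, ho, Xor]
      · simp [mem_coMixedVertex, memB, ha, lt_succ]
    have t1 : (-1 : ℤ) ^ (M.card + numBelow M l) = -1 := by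
      apply Odd.neg_one_pow
      rw [Nat.odd_iff] at ho ⊢
      omega
    have t2 : (-1 : ℤ) ^ (M.card + 1 + numBelow M l) = 1 := by
      apply Even.neg_one_pow
      rw [Nat.odd_iff] at ho
      rw [Nat.even_iff]
      omega
    rw [a1, b1, a2, b2, t1, t2, signedTerm, signedTerm, one_smul, neg_one_smul_tensor]
    abel
  · have a1 : mixedVertex M l = A := by
      ext a
      by_cases ha : a = l
      · subst ha; simp [mem_mixedVertex, memA, ho, Xor]
      · simp [mem_mixedVertex, memA, ha]
    have b1 : coMixedVertex M l = insert l B := by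
      ext a
      by_cases ha : a = l
      · subst ha; simp [mem_coMixedVertex, hl, ho, Xor]
      · simp [mem_coMixedVertex, memB, ha]
    have a2 : mixedVertex M (l + 1) = insert l A := by
      ext a
      by_cases ha : a = l
      · subst ha; simp [mem_mixedVertex, hl, ho, Xor]
      · simp [mem_mixedVertex, memA, ha, lt_succ]
    have b2 : coMixedVertex M (l + 1) = B := by
      ext a
      by_cases ha : a = l
      · subst ha; simp [mem_coMixedVertex, memB, ho, Xor]
      · simp [mem_coMixedVertex, memB, ha, lt_succ]
    have t1 : (-1 : ℤ) ^ (M.card + numBelow M l) = 1 := by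
      apply Even.neg_one_pow
      rw [Nat.odd_iff] at ho
      rw [Nat.even_iff]
      omega
    have t2 : (-1 : ℤ) ^ (M.card + 1 + numBelow M l) = -1 := by
      apply Odd.neg_one_pow
      rw [Nat.odd_iff] at ho ⊢
      omega
    rw [a1, b1, a2, b2, t1, t2, signedTerm, signedTerm, one_smul, neg_one_smul_tensor]
    abel

/-- The facets of all terms telescope. -/
theorem sum_facets_telescope {p : ℕ} (σ : SingularSimplex X p) (M : Finset (Fin (p + 1))) :
    ∑ l ∈ Mᶜ, (signedTerm σ M (mixedVertex M l) (coMixedVertex M l) -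
      signedTerm σ M (mixedVertex M (l + 1)) (coMixedVertex M (l + 1))) =
    signedTerm σ M (initialVertex ∅ M) (coInitialVertex ∅ M) -
      signedTerm σ M (coInitialVertex ∅ M) (initialVertex ∅ M) := by
  -- The path stands still at vertices of `M`, so the sum may be extended to all of `[0, p]`.
  have hstep : ∀ l ∈ (Finset.univ : Finset (Fin (p + 1))), l ∉ Mᶜ →
      signedTerm σ M (mixedVertex M l) (coMixedVertex M l) -
        signedTerm σ M (mixedVertex M (l + 1)) (coMixedVertex M (l + 1)) = 0 := by
    intro l _ hl
    rw [Finset.mem_compl, not_not] at hl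
    have h : mixedVertex M l = mixedVertex M (l + 1) := by
      ext a
      rw [mem_mixedVertex, mem_mixedVertex]
      refine and_congr_right fun ha => ?_
      have : (a : ℕ) ≠ l := fun h => ha (Fin.ext h ▸ hl)
      have : (a : ℕ) < l ↔ (a : ℕ) < l + 1 := by omega
      rw [this]
    rw [coMixedVertex, coMixedVertex, h, sub_self]
  rw [Finset.sum_subset (Finset.subset_univ _) hstep]
  have := Fin.sum_univ_eq_sum_range (fun k : ℕ => signedTerm σ M (mixedVertex M k)
    (coMixedVertex M k) - signedTerm σ M (mixedVertex M (k + 1)) (coMixedVertex M (k + 1))) (p + 1)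
  rw [this, Finset.sum_range_sub', mixedVertex_zero, coMixedVertex_zero, mixedVertex_last,
    coMixedVertex_last]

/-- The part of the boundary of a term that is supported on proper faces. -/
def properFaceTerm {p : ℕ} (σ : SingularSimplex X p) (L V : Finset (Fin (p + 1))) :
    Chains X ⊗[ℤ] Chains X :=
  (-1 : ℤ) ^ relSignExponent V.card L (initialVertex ∅ L ∩ V) (coInitialVertex ∅ L ∩ V) •
    facePair σ (L ∪ initialVertex ∅ L ∩ V) (L ∪ coInitialVertex ∅ L ∩ V)

/-- A vertex outside `L` occurs in one factor and contributes one facet, which is again a term of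
the same `L`; a vertex of `L` occurs in both factors and contributes two. -/
theorem tensorBoundary_signedTerm (i : ℕ) {p : ℕ} (σ : SingularSimplex X p)
    (L : Finset (Fin (p + 1))) (hL : L.card = i + 1) :
    tensorBoundary X (signedTerm σ L (initialVertex ∅ L) (coInitialVertex ∅ L)) =
      ∑ j ∈ Lᶜ, (-1 : ℤ) ^ (i + (j : ℕ)) • properFaceTerm σ L (Finset.univ.erase j) +
      ∑ l ∈ L, ((-1 : ℤ) ^ (signExponent L (initialVertex ∅ L) (coInitialVertex ∅ L) +
            numBelow (L ∪ initialVertex ∅ L) l) •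
          facePair σ ((L ∪ initialVertex ∅ L).erase l) (L ∪ coInitialVertex ∅ L) +
        (-1 : ℤ) ^ (signExponent L (initialVertex ∅ L) (coInitialVertex ∅ L) +
            ((L ∪ initialVertex ∅ L).card - 1 + numBelow (L ∪ coInitialVertex ∅ L) l)) •
          facePair σ (L ∪ initialVertex ∅ L) ((L ∪ coInitialVertex ∅ L).erase l)) := by
  have hLA := disjoint_initialVertex L
  have hB : coInitialVertex ∅ L = (L ∪ initialVertex ∅ L)ᶜ := rfl
  have hLne : L.Nonempty := Finset.card_pos.mp (by omega)
  rw [signedTerm]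
  generalize hAe : initialVertex ∅ L = A at *
  generalize hBe : coInitialVertex ∅ L = B at *
  have hLB : Disjoint L B := by
    rw [hB]
    exact disjoint_compl_right.mono_left Finset.subset_union_left
  have hAB : Disjoint A B := by
    rw [hB]
    exact disjoint_compl_right.mono_left Finset.subset_union_right
  have hcompl : Lᶜ = A ∪ B := by
    ext a
    simp only [hB, Finset.mem_compl, Finset.mem_union]
    have : a ∈ L → a ∉ A := fun h => Finset.disjoint_left.mp hLA h
    tauto
  have hcard : ∀ j : Fin (p + 1), (Finset.univ.erase j).card = p := fun j => by simp
  have inter_erase : ∀ (C : Finset (Fin (p + 1))) j, C ∩ Finset.univ.erase j = C.erase j := by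
    intro C j; ext; simp; tauto
  rw [map_smul, facePair, tensorBoundary_faceChain, smul_add, Finset.smul_sum, Finset.smul_sum,
    Finset.sum_union hLA, Finset.sum_union hLB, hcompl, Finset.sum_union hAB,
    Finset.sum_add_distrib]
  have hpA : ∀ j ∈ A, (-1 : ℤ) ^ signExponent L A B • (-1 : ℤ) ^ numBelow (L ∪ A) j •
      (faceChain σ ((L ∪ A).erase j) ⊗ₜ[ℤ] faceChain σ (L ∪ B)) =
      (-1 : ℤ) ^ (i + (j : ℕ)) • properFaceTerm σ L (Finset.univ.erase j) := by
    intro j hj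
    have hjL : j ∉ L := Finset.disjoint_right.mp hLA hj
    have hjB : j ∉ B := Finset.disjoint_left.mp hAB hj
    rw [properFaceTerm, hAe, hBe, inter_erase, inter_erase, hcard, Finset.erase_eq_of_notMem hjB,
      smul_smul, smul_smul, ← pow_add, ← pow_add,
      neg_one_pow_eq_of_mod (signExponent_erase_left hLA hB hj), hL, facePair,
      Finset.erase_union_distrib, Finset.erase_eq_of_notMem hjL]
    congr 1
    apply neg_one_pow_eq_of_mod
    omega
  have hpB : ∀ j ∈ B, (-1 : ℤ) ^ signExponent L A B •
      (-1 : ℤ) ^ ((L ∪ A).card - 1 + numBelow (L ∪ B) j) •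
      (faceChain σ (L ∪ A) ⊗ₜ[ℤ] faceChain σ ((L ∪ B).erase j)) =
      (-1 : ℤ) ^ (i + (j : ℕ)) • properFaceTerm σ L (Finset.univ.erase j) := by
    intro j hj
    have hjL : j ∉ L := Finset.disjoint_right.mp hLB hj
    have hjA : j ∉ A := Finset.disjoint_right.mp hAB hj
    rw [properFaceTerm, hAe, hBe, inter_erase, inter_erase, hcard, Finset.erase_eq_of_notMem hjA,
      smul_smul, smul_smul, ← pow_add, ← pow_add,
      neg_one_pow_eq_of_mod (signExponent_erase_right hLA hB hLne hj), hL, facePair,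
      Finset.erase_union_distrib, Finset.erase_eq_of_notMem hjL]
    congr 1
    apply neg_one_pow_eq_of_mod
    omega
  rw [Finset.sum_congr rfl hpA, Finset.sum_congr rfl hpB]
  simp only [smul_smul, ← pow_add, facePair]
  abel

theorem cubillageValue_eq (i : ℕ) {p : ℕ} (σ : SingularSimplex X p) :
    cubillageValue i ∅ σ = ∑ L ∈ Finset.powersetCard (i + 1) Finset.univ,
      signedTerm σ L (initialVertex ∅ L) (coInitialVertex ∅ L) := rfl

/-- The last station of the path of `M` is the transpose of the first; its sign yields the summand
`(-1)^(i+1) T Δ_i^∅` of the homotopy formula in degree `i + 1`. -/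
theorem swap_signedTerm {p : ℕ} (σ : SingularSimplex X p) {i : ℕ} (M : Finset (Fin (p + 1)))
    (hM : M.card = i + 1) :
    signedTerm σ M (coInitialVertex ∅ M) (initialVertex ∅ M) =
      -((-1 : ℤ) ^ (i + 1) •
        swap X (signedTerm σ M (initialVertex ∅ M) (coInitialVertex ∅ M))) := by
  have h := signExponent_swap (disjoint_initialVertex M)
    (show coInitialVertex ∅ M = (M ∪ initialVertex ∅ M)ᶜ from rfl)
    (Finset.card_pos.mp (by omega))
  rw [hM] at h
  rw [signedTerm, signedTerm, map_smul, facePair, facePair, swap_faceChain, smul_smul, smul_smul,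
    ← pow_add, ← pow_add, ← neg_smul_tensor]
  congr 1
  have h' : ∀ n : ℕ, -(-1 : ℤ) ^ n = (-1) ^ (n + 1) := fun n => by ring
  rw [h']
  apply neg_one_pow_eq_of_mod
  rw [← add_assoc] at h
  omega

/-- Regroups the facets in directions `l ∈ L` by `M = L \ l`, along which they telescope. -/
theorem sum_powersetCard_succ {p i : ℕ} {N : Type*} [AddCommMonoid N]
    (f : Finset (Fin (p + 1)) → Fin (p + 1) → N) :
    ∑ L ∈ Finset.powersetCard (i + 1) (Finset.univ : Finset (Fin (p + 1))), ∑ l ∈ L, f L l =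
      ∑ M ∈ Finset.powersetCard i (Finset.univ : Finset (Fin (p + 1))), ∑ l ∈ Mᶜ,
        f (insert l M) l := by
  rw [Finset.sum_sigma', Finset.sum_sigma']
  refine Finset.sum_bij' (fun x _ => ⟨x.1.erase x.2, x.2⟩) (fun x _ => ⟨insert x.2 x.1, x.2⟩)
    ?_ ?_ ?_ ?_ ?_
  · rintro ⟨L, l⟩ h
    simp only [Finset.mem_sigma, Finset.mem_powersetCard, Finset.subset_univ, true_and,
      Finset.mem_compl, Finset.notMem_erase, not_false_eq_true, and_true] at h ⊢
    rw [Finset.card_erase_of_mem h.2, h.1, Nat.add_sub_cancel]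
  · rintro ⟨M, l⟩ h
    simp only [Finset.mem_sigma, Finset.mem_powersetCard, Finset.subset_univ, true_and,
      Finset.mem_compl] at h ⊢
    rw [Finset.card_insert_of_notMem h.2, h.1]
    exact ⟨rfl, Finset.mem_insert_self _ _⟩
  · rintro ⟨L, l⟩ h
    simp only [Finset.mem_sigma] at h
    simp [Finset.insert_erase h.2]
  · rintro ⟨M, l⟩ h
    simp only [Finset.mem_sigma, Finset.mem_compl] at h
    simp [Finset.erase_insert h.2]
  · rintro ⟨L, l⟩ h
    simp only [Finset.mem_sigma] at h
    simp [Finset.insert_erase h.2]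

theorem homotopyFormula_deltaEmpty (X : Type*) [TopologicalSpace X] (i : ℕ) :
    HomotopyFormula i (deltaEmpty X i) := by
  apply chains_hom_ext
  intro p σ
  rw [LinearMap.sub_apply, LinearMap.smul_apply, LinearMap.comp_apply, LinearMap.comp_apply,
    LinearMap.comp_apply, LinearMap.add_apply, LinearMap.smul_apply, LinearMap.id_apply,
    deltaEmpty_simplexChain, cubillageValue_eq, map_sum]
  have h1 := Finset.sum_congr (rfl : Finset.powersetCard (i + 1)
    (Finset.univ : Finset (Fin (p + 1))) = _) fun L hL =>
    tensorBoundary_signedTerm i σ L (Finset.mem_powersetCard.mp hL).2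
  rw [h1, Finset.sum_add_distrib, sum_powersetCard_succ]
  have h2 : ∑ L ∈ Finset.powersetCard (i + 1) (Finset.univ : Finset (Fin (p + 1))), ∑ j ∈ Lᶜ,
      (-1 : ℤ) ^ (i + (j : ℕ)) • properFaceTerm σ L (Finset.univ.erase j) =
      (-1 : ℤ) ^ i • deltaEmpty X i (boundary X (simplexChain σ)) := by
    rw [boundary_simplexChain, map_sum, Finset.smul_sum]
    have hj : ∀ j ∈ (Finset.univ : Finset (Fin (p + 1))),
        (-1 : ℤ) ^ i • deltaEmpty X i ((-1 : ℤ) ^ (j : ℕ) •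
          faceChain σ (Finset.univ.erase j)) =
        ∑ L ∈ Finset.powersetCard (i + 1) (Finset.univ.erase j),
          (-1 : ℤ) ^ (i + (j : ℕ)) • properFaceTerm σ L (Finset.univ.erase j) := fun j _ => by
      rw [map_smul, deltaEmpty_faceChain, smul_smul, ← pow_add, Finset.smul_sum]
      rfl
    rw [Finset.sum_congr rfl hj, Finset.sum_comm' (t' := Finset.univ)
      (s' := fun j => Finset.powersetCard (i + 1) (Finset.univ.erase j))]
    · intro L j
      simp only [Finset.mem_powersetCard, Finset.subset_univ, true_and, Finset.mem_compl,
        Finset.mem_univ, and_true]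
      rw [and_comm]
      refine and_congr_left fun _ => ?_
      rw [Finset.subset_erase]
      simp
  rw [h2, add_sub_cancel_left]
  have h3 : ∀ M : Finset (Fin (p + 1)), _ := fun M => sum_facets_telescope σ M
  have h4 : ∀ M ∈ Finset.powersetCard i (Finset.univ : Finset (Fin (p + 1))), _ := fun M _ =>
    (Finset.sum_congr rfl fun l hl =>
      facets_eq_sub σ (Finset.mem_compl.mp hl) _ _ rfl rfl).trans (h3 M)
  rw [Finset.sum_congr rfl h4]
  cases i with
  | zero =>
    -- In degree zero only `M = ∅` occurs. Its `A`-side is empty, so both ends of the path have the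
    -- empty face as a factor and vanish.
    rw [Finset.powersetCard_zero, Finset.sum_singleton]
    have hA : initialVertex ∅ (∅ : Finset (Fin (p + 1))) = ∅ := by
      ext a
      simp [mem_initialVertex_empty, numAbove]
    rw [hA]
    simp [deltaEmptyPred, signedTerm]
  | succ i =>
    rw [deltaEmptyPred, deltaEmpty_simplexChain, cubillageValue_eq, map_sum, Finset.smul_sum,
      ← Finset.sum_add_distrib]
    refine Finset.sum_congr rfl fun M hM => ?_
    rw [swap_signedTerm σ M (Finset.mem_powersetCard.mp hM).2, sub_neg_eq_add]

/-! ### Singular simplices with prescribed coincidences of faces -/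

/-- The path is composed with a Urysohn function for the two finite, hence closed, sets. -/
theorem exists_simplex_of_disjoint {x y : X} (h : Joined x y) {p : ℕ}
    {Z Q : Set (stdSimplex ℝ (Fin (p + 1)))} (hZ : Z.Finite) (hQ : Q.Finite)
    (hZQ : Disjoint Z Q) :
    ∃ σ : SingularSimplex X p, (∀ s ∈ Z, σ s = x) ∧ ∀ s ∈ Q, σ s = y := by
  obtain ⟨γ⟩ := h
  obtain ⟨f, hf0, hf1, -⟩ := exists_continuous_zero_one_of_isClosed hZ.isClosed hQ.isClosed hZQ
  refine ⟨⟨fun s => γ.extend (f s), γ.continuous_extend.comp f.continuous⟩, fun s hs => ?_,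
    fun s hs => ?_⟩
  · simp [hf0 hs]
  · simp [hf1 hs]

theorem barycenter_apply_fin (m : ℕ) (k : Fin (m + 1)) :
    (stdSimplex.barycenter : stdSimplex ℝ (Fin (m + 1))) k = (m + 1 : ℝ)⁻¹ :=
  (stdSimplex.barycenter_apply k).trans (by simp)

/-- An interior point of a simplex, different from the barycenter in positive dimensions. -/
def skewPoint (m : ℕ) : stdSimplex ℝ (Fin (m + 1)) :=
  ⟨(1 / 2 : ℝ) • (stdSimplex.barycenter : stdSimplex ℝ (Fin (m + 1))).1 +
      (1 / 2 : ℝ) • (stdSimplex.vertex 0 : stdSimplex ℝ (Fin (m + 1))).1,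
    convex_stdSimplex ℝ _ (Subtype.prop _) (Subtype.prop _) (by norm_num) (by norm_num)
      (by norm_num)⟩

theorem skewPoint_apply (m : ℕ) (k : Fin (m + 1)) :
    skewPoint m k = 1 / 2 * (m + 1 : ℝ)⁻¹ + 1 / 2 * if k = 0 then 1 else 0 := by
  have h1 : skewPoint m k = 1 / 2 * (stdSimplex.barycenter : stdSimplex ℝ (Fin (m + 1))) k +
      1 / 2 * (stdSimplex.vertex 0 : stdSimplex ℝ (Fin (m + 1))) k := rfl
  rw [h1, barycenter_apply_fin, stdSimplex.vertex_coe, Pi.single_apply]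

theorem skewPoint_pos (m : ℕ) (k : Fin (m + 1)) : 0 < skewPoint m k := by
  rw [skewPoint_apply]
  split_ifs <;> positivity

theorem barycenter_pos (m : ℕ) (k : Fin (m + 1)) :
    0 < (stdSimplex.barycenter : stdSimplex ℝ (Fin (m + 1))) k := by
  rw [barycenter_apply_fin]
  positivity

theorem barycenter_ne_skewPoint {m : ℕ} (hm : m ≠ 0) :
    (stdSimplex.barycenter : stdSimplex ℝ (Fin (m + 1))) ≠ skewPoint m := by
  intro h
  have h0 := congrArg (fun s : stdSimplex ℝ (Fin (m + 1)) => s 0) h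
  simp only [skewPoint_apply, barycenter_apply_fin, if_true] at h0
  have h1 : (m + 1 : ℝ)⁻¹ = 1 := by linarith
  rw [inv_eq_one] at h1
  exact hm (by exact_mod_cast (by linarith : (m : ℝ) = 0))

theorem map_apply_of_injective {m n : ℕ} {e : Fin m → Fin n} (he : Function.Injective e)
    (s : stdSimplex ℝ (Fin m)) (k : Fin m) : stdSimplex.map e s (e k) = s k := by
  rw [stdSimplex.map_coe, FunOnFinite.linearMap_apply_apply]
  rw [Finset.sum_eq_single k]
  · intro b hb hbk
    exact absurd (he (by simpa using hb)) hbk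
  · simp

theorem map_apply_of_notMem_range {m n : ℕ} {e : Fin m → Fin n} (s : stdSimplex ℝ (Fin m))
    {a : Fin n} (ha : a ∉ Set.range e) : stdSimplex.map e s a = 0 := by
  rw [stdSimplex.map_coe, FunOnFinite.linearMap_apply_apply]
  apply Finset.sum_eq_zero
  intro b hb
  exact absurd ⟨b, by simpa using hb⟩ ha

/-- The image of a family of points of the standard simplices in the face spanned by `S`. -/
def facePoint (b : ∀ m : ℕ, stdSimplex ℝ (Fin (m + 1))) {p : ℕ} (S : Finset (Fin (p + 1)))
    (hS : S.Nonempty) : stdSimplex ℝ (Fin (p + 1)) :=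
  stdSimplex.map (vertexMap S hS) (b (S.card - 1))

/-- An interior point of a face remembers the face through its support. -/
theorem facePoint_pos_iff {b : ∀ m : ℕ, stdSimplex ℝ (Fin (m + 1))} (hb : ∀ m k, 0 < b m k)
    {p : ℕ} (S : Finset (Fin (p + 1))) (hS : S.Nonempty) (a : Fin (p + 1)) :
    0 < facePoint b S hS a ↔ a ∈ S := by
  have hmem : a ∈ S ↔ a ∈ Set.range (vertexMap S hS) := by
    conv_lhs => rw [← map_vertexMap_univ S hS]
    simp
  rw [hmem]
  constructor
  · intro h
    by_contra hn
    rw [facePoint, map_apply_of_notMem_range _ hn] at h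
    exact lt_irrefl _ h
  · rintro ⟨k, rfl⟩
    rw [facePoint, map_apply_of_injective (vertexMap S hS).injective]
    exact hb _ _

theorem eq_of_facePoint_eq {b c : ∀ m : ℕ, stdSimplex ℝ (Fin (m + 1))} (hb : ∀ m k, 0 < b m k)
    (hc : ∀ m k, 0 < c m k) {p : ℕ} {S T : Finset (Fin (p + 1))} {hS : S.Nonempty}
    {hT : T.Nonempty} (h : facePoint b S hS = facePoint c T hT) : S = T := by
  ext a
  rw [← facePoint_pos_iff hb S hS, ← facePoint_pos_iff hc T hT, h]

theorem point_eq_of_facePoint_eq {b c : ∀ m : ℕ, stdSimplex ℝ (Fin (m + 1))}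
    {p : ℕ} {S : Finset (Fin (p + 1))} {hS : S.Nonempty}
    (h : facePoint b S hS = facePoint c S hS) : b (S.card - 1) = c (S.card - 1) := by
  ext k
  have := congrArg (fun s : stdSimplex ℝ (Fin (p + 1)) => s (vertexMap S hS k)) h
  simpa only [facePoint, map_apply_of_injective (vertexMap S hS).injective] using this

/-- The face of a singular simplex, together with its dimension. -/
def sigmaFace {p : ℕ} (σ : SingularSimplex X p) (S : Finset (Fin (p + 1))) (hS : S.Nonempty) :
    Σ q : ℕ, SingularSimplex X q :=
  ⟨S.card - 1, face σ S hS⟩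

theorem eval_eq_of_sigmaFace_eq (b : ∀ m : ℕ, stdSimplex ℝ (Fin (m + 1))) {p : ℕ}
    {σ : SingularSimplex X p} {S T : Finset (Fin (p + 1))} {hS : S.Nonempty} {hT : T.Nonempty}
    (h : sigmaFace σ S hS = sigmaFace σ T hT) :
    σ (facePoint b S hS) = σ (facePoint b T hT) :=
  congrArg (fun s : Σ q : ℕ, SingularSimplex X q => s.2 (b s.1)) h

theorem card_eq_of_sigmaFace_eq {p : ℕ} {σ : SingularSimplex X p} {S T : Finset (Fin (p + 1))}
    {hS : S.Nonempty} {hT : T.Nonempty} (h : sigmaFace σ S hS = sigmaFace σ T hT) :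
    S.card = T.card := by
  have h1 : S.card - 1 = T.card - 1 := congrArg Sigma.fst h
  have := hS.card_pos
  have := hT.card_pos
  omega

theorem finite_setOf_facePoint (b : ∀ m : ℕ, stdSimplex ℝ (Fin (m + 1))) {p : ℕ}
    (P : Finset (Fin (p + 1)) → Prop) :
    {s | ∃ S hS, P S ∧ s = facePoint b (p := p) S hS}.Finite := by
  refine (Set.finite_range fun S : {S : Finset (Fin (p + 1)) // S.Nonempty} =>
    facePoint b S.1 S.2).subset ?_
  rintro s ⟨S, hS, -, rfl⟩
  exact ⟨⟨S, hS⟩, rfl⟩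

/-- A singular simplex for which a given pair of faces differs from all other pairs of faces. -/
theorem exists_simplex_separating (hX : ∃ x y : X, x ≠ y ∧ Joined x y) {p : ℕ}
    {S₀ T₀ : Finset (Fin (p + 1))} (hS₀ : S₀.Nonempty) (hT₀ : T₀.Nonempty)
    (h : 3 ≤ S₀.card + T₀.card ∨ p ≤ 1) :
    ∃ σ : SingularSimplex X p,
      (∀ S hS, sigmaFace σ S hS = sigmaFace σ S₀ hS₀ → S = S₀) ∧
      (∀ T hT, sigmaFace σ T hT = sigmaFace σ T₀ hT₀ → T = T₀) := by
  obtain ⟨x, y, hxy, hj⟩ := hX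
  -- Barycenters test the first factor and skew points the second: `σ` is `y` at the test points of
  -- `S₀` and `T₀`, and `x` at those of the other faces of the same dimensions. Two kinds of points
  -- are needed because `T₀` itself may be one of the other faces for `S₀`.
  let b : ∀ m : ℕ, stdSimplex ℝ (Fin (m + 1)) := fun m => stdSimplex.barycenter
  let c : ∀ m : ℕ, stdSimplex ℝ (Fin (m + 1)) := skewPoint
  have hb : ∀ m k, 0 < b m k := barycenter_pos
  have hc : ∀ m k, 0 < c m k := skewPoint_pos
  have hS₁ := hS₀.card_pos
  have hT₁ := hT₀.card_pos
  by_cases hgen : S₀ = T₀ ∨ S₀.card ≠ T₀.card ∨ 2 ≤ S₀.card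
  · obtain ⟨σ, hσx, hσy⟩ := exists_simplex_of_disjoint hj
      (Z := {s | ∃ S hS, (S.card = S₀.card ∧ S ≠ S₀) ∧ s = facePoint b S hS} ∪
        {s | ∃ T hT, (T.card = T₀.card ∧ T ≠ T₀) ∧ s = facePoint c T hT})
      (Q := {facePoint b S₀ hS₀, facePoint c T₀ hT₀})
      ((finite_setOf_facePoint b _).union (finite_setOf_facePoint c _)) (Set.toFinite _) (by
        rw [Set.disjoint_left]
        rintro s (⟨S, hS, ⟨hcard, hne⟩, rfl⟩ | ⟨S, hS, ⟨hcard, hne⟩, rfl⟩) (hs | hs)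
        · exact hne (eq_of_facePoint_eq hb hb hs)
        · obtain rfl := eq_of_facePoint_eq hb hc hs
          rcases hgen with h | h | h
          · exact hne h.symm
          · exact h hcard.symm
          · exact barycenter_ne_skewPoint (by omega) (point_eq_of_facePoint_eq hs)
        · obtain rfl := eq_of_facePoint_eq hc hb hs
          rcases hgen with h | h | h
          · exact hne h
          · exact h hcard
          · exact barycenter_ne_skewPoint (by omega) (point_eq_of_facePoint_eq hs).symm
        · exact hne (eq_of_facePoint_eq hc hc hs))
    refine ⟨σ, fun S hS hs => ?_, fun T hT ht => ?_⟩
    · by_contra hne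
      have := eval_eq_of_sigmaFace_eq b hs
      rw [hσx _ (Or.inl ⟨S, hS, ⟨card_eq_of_sigmaFace_eq hs, hne⟩, rfl⟩),
        hσy _ (Or.inl rfl)] at this
      exact hxy this
    · by_contra hne
      have := eval_eq_of_sigmaFace_eq c ht
      rw [hσx _ (Or.inr ⟨T, hT, ⟨card_eq_of_sigmaFace_eq ht, hne⟩, rfl⟩),
        hσy _ (Or.inr rfl)] at this
      exact hxy this
  -- The two kinds of points coincide for vertices. If `S₀` and `T₀` are distinct vertices, then `p
  -- ≤ 1`, there is no third vertex, and it suffices to separate these two. For `p ≥ 2` this could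
  -- fail: `X` may have only two points.
  · push Not at hgen
    obtain ⟨hne₀, hcard₀, hlt⟩ := hgen
    obtain ⟨u, hu⟩ := Finset.card_eq_one.mp (show S₀.card = 1 by omega)
    obtain ⟨v, hv⟩ := Finset.card_eq_one.mp (show T₀.card = 1 by omega)
    have huv : u ≠ v := fun h => hne₀ (by rw [hu, hv, h])
    have hp : p ≤ 1 := by omega
    have hall : ∀ S : Finset (Fin (p + 1)), S.card = 1 → S = S₀ ∨ S = T₀ := by
      intro S hS
      obtain ⟨w, rfl⟩ := Finset.card_eq_one.mp hS
      rw [hu, hv, Finset.singleton_inj, Finset.singleton_inj, Fin.ext_iff, Fin.ext_iff]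
      rw [Ne, Fin.ext_iff] at huv
      omega
    obtain ⟨σ, hσx, hσy⟩ := exists_simplex_of_disjoint hj
      (Z := {facePoint b T₀ hT₀}) (Q := {facePoint b S₀ hS₀}) (Set.toFinite _) (Set.toFinite _) (by
        rw [Set.disjoint_singleton]
        exact fun h => hne₀ (eq_of_facePoint_eq hb hb h).symm)
    have hx := hσx _ rfl
    have hy := hσy _ rfl
    refine ⟨σ, fun S hS hs => ?_, fun T hT ht => ?_⟩
    · refine (hall S (by rw [card_eq_of_sigmaFace_eq hs]; omega)).resolve_right ?_
      rintro rfl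
      have := eval_eq_of_sigmaFace_eq b hs
      rw [hx, hy] at this
      exact hxy this
    · refine (hall T (by rw [card_eq_of_sigmaFace_eq ht]; omega)).resolve_left ?_
      rintro rfl
      have := eval_eq_of_sigmaFace_eq b ht
      rw [hx, hy] at this
      exact hxy this.symm

/-- The coefficient of a basis element of the tensor square of the singular chains. -/
def tensorCoeff (s t : Σ q : ℕ, SingularSimplex X q) : Chains X ⊗[ℤ] Chains X →ₗ[ℤ] ℤ :=
  TensorProduct.lift ((LinearMap.mul ℤ ℤ).compl₁₂ (Finsupp.lapply s) (Finsupp.lapply t))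

theorem tensorCoeff_tmul (s t : Σ q : ℕ, SingularSimplex X q) (a b : Chains X) :
    tensorCoeff s t (a ⊗ₜ[ℤ] b) = a s * b t := rfl

theorem faceChain_apply_sigmaFace {p : ℕ} {σ : SingularSimplex X p} {S₀ : Finset (Fin (p + 1))}
    {hS₀ : S₀.Nonempty} (h : ∀ S hS, sigmaFace σ S hS = sigmaFace σ S₀ hS₀ → S = S₀)
    (S : Finset (Fin (p + 1))) :
    faceChain σ S (sigmaFace σ S₀ hS₀) = if S = S₀ then 1 else 0 := by
  rcases S.eq_empty_or_nonempty with rfl | hS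
  · rw [faceChain_empty, if_neg hS₀.ne_empty.symm]
    rfl
  · rw [faceChain_of_nonempty σ hS, simplexChain]
    by_cases hSS : S = S₀
    · subst hSS
      rw [if_pos rfl]
      exact Finsupp.single_eq_same
    · rw [if_neg hSS]
      refine Finsupp.single_eq_of_ne' ?_
      exact fun he => hSS (h S hS he)

/-- Pairs of faces of generic simplices are linearly independent. -/
theorem exists_coeff_functional (hX : ∃ x y : X, x ≠ y ∧ Joined x y) {p : ℕ}
    {S₀ T₀ : Finset (Fin (p + 1))} (hS₀ : S₀.Nonempty) (hT₀ : T₀.Nonempty)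
    (h : 3 ≤ S₀.card + T₀.card ∨ p ≤ 1) :
    ∃ (σ : SingularSimplex X p) (φ : Chains X ⊗[ℤ] Chains X →ₗ[ℤ] ℤ), ∀ S T,
      φ (faceChain σ S ⊗ₜ[ℤ] faceChain σ T) = if S = S₀ ∧ T = T₀ then 1 else 0 := by
  obtain ⟨σ, hS, hT⟩ := exists_simplex_separating hX hS₀ hT₀ h
  refine ⟨σ, tensorCoeff (sigmaFace σ S₀ hS₀) (sigmaFace σ T₀ hT₀), fun S T => ?_⟩
  rw [tensorCoeff_tmul, faceChain_apply_sigmaFace hS, faceChain_apply_sigmaFace hT]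
  split_ifs <;> simp_all

/-! ### Formal cycles -/

/-- The value on a simplex of a formal combination of pairs of faces. -/
def formalValue {p : ℕ} (z : Finset (Fin (p + 1)) → Finset (Fin (p + 1)) → ℤ)
    (σ : SingularSimplex X p) : Chains X ⊗[ℤ] Chains X :=
  ∑ S, ∑ T, z S T • (faceChain σ S ⊗ₜ[ℤ] faceChain σ T)

/-- The coefficient of `S ⊗ T` in the boundary of a formal combination vanishes if `S`, `T` are
non-empty. -/
def FormalCycle {p : ℕ} (z : Finset (Fin (p + 1)) → Finset (Fin (p + 1)) → ℤ) : Prop :=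
  ∀ S T : Finset (Fin (p + 1)), S.Nonempty → T.Nonempty →
    ∑ s ∈ Sᶜ, (-1 : ℤ) ^ numBelow S s * z (insert s S) T +
      ∑ t ∈ Tᶜ, (-1 : ℤ) ^ (S.card - 1 + numBelow T t) * z S (insert t T) = 0

theorem sum_erase_eq {p : ℕ} (S₀ : Finset (Fin (p + 1))) (g : Finset (Fin (p + 1)) → ℤ) :
    ∑ S, ∑ s ∈ S, (-1 : ℤ) ^ numBelow S s * (if S.erase s = S₀ then g S else 0) =
      ∑ s ∈ S₀ᶜ, (-1 : ℤ) ^ numBelow S₀ s * g (insert s S₀) := by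
  simp only [mul_ite, mul_zero]
  rw [Finset.sum_sigma', ← Finset.sum_filter]
  refine Finset.sum_bij' (fun x _ => x.2) (fun s _ => ⟨insert s S₀, s⟩) ?_ ?_ ?_ ?_ ?_
  · rintro ⟨S, s⟩ h
    simp only [Finset.mem_filter] at h
    rw [← h.2]
    simp
  · intro s h
    rw [Finset.mem_compl] at h
    simp [h]
  · rintro ⟨S, s⟩ h
    simp only [Finset.mem_filter, Finset.mem_sigma] at h
    simp [← h.2, Finset.insert_erase h.1.2]
  · simp
  · rintro ⟨S, s⟩ h
    simp only [Finset.mem_filter, Finset.mem_sigma] at h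
    have h' : insert s S₀ = S := by rw [← h.2, Finset.insert_erase h.1.2]
    rw [← numBelow_insert_self S₀ s, h']

/-- The coefficient functional of a simplex separating `S₀ ⊗ T₀` extracts the condition at this
pair. The bound `4` leaves at least three vertices after a boundary, as the separation needs. -/
theorem formalCycle_of_tensorBoundary_eq_zero (hX : ∃ x y : X, x ≠ y ∧ Joined x y) {p : ℕ}
    {z : Finset (Fin (p + 1)) → Finset (Fin (p + 1)) → ℤ}
    (hz : ∀ S T, z S T ≠ 0 → 4 ≤ S.card + T.card ∨ p ≤ 1)
    (h : ∀ σ : SingularSimplex X p, tensorBoundary X (formalValue z σ) = 0) : FormalCycle z := by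
  intro S₀ T₀ hS₀ hT₀
  by_cases hgen : 3 ≤ S₀.card + T₀.card ∨ p ≤ 1
  · obtain ⟨σ, φ, hφ⟩ := exists_coeff_functional hX hS₀ hT₀ hgen
    have hST : ∀ S T, φ (tensorBoundary X (faceChain σ S ⊗ₜ[ℤ] faceChain σ T)) =
        ∑ s ∈ S, (-1 : ℤ) ^ numBelow S s * (if S.erase s = S₀ ∧ T = T₀ then 1 else 0) +
        ∑ t ∈ T, (-1 : ℤ) ^ (S.card - 1 + numBelow T t) *
          (if S = S₀ ∧ T.erase t = T₀ then 1 else 0) := by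
      intro S T
      rw [tensorBoundary_faceChain, map_add, map_sum, map_sum]
      congr 1 <;> refine Finset.sum_congr rfl fun x _ => ?_ <;> rw [map_smul, hφ, smul_eq_mul]
    have h1 : φ (tensorBoundary X (formalValue z σ)) =
        ∑ S, ∑ T, z S T * φ (tensorBoundary X (faceChain σ S ⊗ₜ[ℤ] faceChain σ T)) := by
      rw [formalValue, map_sum, map_sum]
      refine Finset.sum_congr rfl fun S _ => ?_
      rw [map_sum, map_sum]
      refine Finset.sum_congr rfl fun T _ => ?_
      rw [map_smul, map_smul, smul_eq_mul]
    rw [h σ, map_zero] at h1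
    simp only [hST, mul_add, Finset.sum_add_distrib] at h1
    rw [h1]
    congr 1
    · rw [← sum_erase_eq S₀ fun S => z S T₀]
      refine Finset.sum_congr rfl fun S _ => ?_
      rw [Finset.sum_eq_single T₀ (fun T _ hT => by simp [hT]) (by simp), Finset.mul_sum]
      refine Finset.sum_congr rfl fun s _ => ?_
      simp only [and_true]
      split_ifs <;> ring
    · rw [Finset.sum_eq_single S₀ (fun S _ hS => by simp [hS]) (by simp)]
      simp only [pow_add, mul_assoc]
      rw [← Finset.mul_sum, ← sum_erase_eq T₀ fun T => z S₀ T, Finset.mul_sum]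
      refine Finset.sum_congr rfl fun T _ => ?_
      rw [Finset.mul_sum, Finset.mul_sum]
      refine Finset.sum_congr rfl fun t _ => ?_
      simp only [true_and]
      split_ifs <;> ring
  -- Here `S₀` and `T₀` are single vertices and `p ≥ 2`; the pairs in the sum have three vertices in
  -- total, so their coefficients vanish by `hz`.
  · have hS₁ := hS₀.card_pos
    have hT₁ := hT₀.card_pos
    rw [Finset.sum_eq_zero, Finset.sum_eq_zero, add_zero]
    · intro t ht
      rw [mul_eq_zero_of_right]
      by_contra hne
      have := hz _ _ hne
      rw [Finset.card_insert_of_notMem (Finset.mem_compl.mp ht)] at this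
      omega
    · intro s hs
      rw [mul_eq_zero_of_right]
      by_contra hne
      have := hz _ _ hne
      rw [Finset.card_insert_of_notMem (Finset.mem_compl.mp hs)] at this
      omega

/-! ### Formal cycles modulo two -/

/-- The reduction modulo two of `FormalCycle`. -/
def FormalCycleModTwo {p : ℕ} (w : Finset (Fin (p + 1)) → Finset (Fin (p + 1)) → ZMod 2) : Prop :=
  ∀ S T : Finset (Fin (p + 1)), S.Nonempty → T.Nonempty →
    ∑ s ∈ Sᶜ, w (insert s S) T + ∑ t ∈ Tᶜ, w S (insert t T) = 0

theorem FormalCycle.modTwo {p : ℕ} {z : Finset (Fin (p + 1)) → Finset (Fin (p + 1)) → ℤ}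
    (h : FormalCycle z) : FormalCycleModTwo fun S T => (z S T : ZMod 2) := by
  intro S T hS hT
  have h1 := congrArg (Int.cast : ℤ → ZMod 2) (h S T hS hT)
  have hneg : (-1 : ZMod 2) = 1 := rfl
  push_cast at h1
  simpa only [hneg, one_pow, one_mul] using h1

/-- This is the cycle condition at `[0, p] ⊗ ∅`, which the definition does not include. In the sum
over `t` of the conditions at `{0}ᶜ ⊗ {t}`, each `{0}ᶜ ⊗ {t, t'}` occurs twice and cancels. -/
theorem FormalCycleModTwo.sum_univ_singleton {p : ℕ} (hp : 1 ≤ p)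
    {w : Finset (Fin (p + 1)) → Finset (Fin (p + 1)) → ZMod 2} (h : FormalCycleModTwo w) :
    ∑ t, w Finset.univ {t} = 0 := by
  set S : Finset (Fin (p + 1)) := {0}ᶜ with hSdef
  have hS : S.Nonempty := Finset.card_pos.mp (by rw [Finset.card_compl]; simp; omega)
  have h1 : ∀ t : Fin (p + 1), w Finset.univ {t} + ∑ t' ∈ {t}ᶜ, w S (insert t' {t}) = 0 := by
    intro t
    have := h S {t} hS (Finset.singleton_nonempty t)
    rw [hSdef, compl_compl, Finset.sum_singleton, Finset.insert_compl_self] at this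
    exact this
  have h2 : ∑ t, ∑ t' ∈ ({t} : Finset (Fin (p + 1)))ᶜ, w S (insert t' {t}) = 0 := by
    rw [Finset.sum_sigma']
    refine Finset.sum_involution (fun x _ => ⟨x.2, x.1⟩) ?_ ?_ ?_ ?_
    · rintro ⟨t, t'⟩ _
      rw [Finset.pair_comm]
      exact CharTwo.add_self_eq_zero _
    · rintro ⟨t, t'⟩ hx _ heq
      simp only [Finset.mem_sigma, Finset.mem_univ, true_and, Finset.mem_compl,
        Finset.mem_singleton] at hx
      exact hx (congrArg Sigma.fst heq)
    · rintro ⟨t, t'⟩ hx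
      simp only [Finset.mem_sigma, Finset.mem_univ, true_and, Finset.mem_compl,
        Finset.mem_singleton] at hx ⊢
      exact fun h => hx h.symm
    · intros; rfl
  have h3 := Finset.sum_congr (rfl : (Finset.univ : Finset (Fin (p + 1))) = _) fun t _ => h1 t
  rw [Finset.sum_add_distrib, h2, add_zero, Finset.sum_const_zero] at h3
  exact h3

/-- The sum of the coefficients of a cycle over all pairs covering `[0, p]` with a given
non-empty intersection is even. -/
theorem FormalCycleModTwo.sum_eq_zero {p : ℕ} (hp : 1 ≤ p)
    {w : Finset (Fin (p + 1)) → Finset (Fin (p + 1)) → ZMod 2} (h : FormalCycleModTwo w)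
    {L : Finset (Fin (p + 1))} (hL : L.Nonempty) :
    ∑ S ∈ Finset.univ.filter (fun S => L ⊆ S), w S (Sᶜ ∪ L) = 0 := by
  obtain ⟨l, hl⟩ := hL
  set M := L.erase l with hM
  have hLM : L = insert l M := (Finset.insert_erase hl).symm
  have hlM : l ∉ M := Finset.notMem_erase l L
  -- The cycle condition at `S ⊗ (Sᶜ ∪ M)`, with the summand of `l` split off. Summed over all `S ⊇
  -- L`, the remaining terms cancel in pairs: moving `s` into `S` matches those of the first sum
  -- with those of the second.
  have h1 : ∀ S ∈ Finset.univ.filter (fun S => L ⊆ S),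
      ∑ s ∈ Sᶜ, w (insert s S) (Sᶜ ∪ M) +
        (w S (Sᶜ ∪ L) + ∑ t ∈ S \ L, w S (insert t (Sᶜ ∪ M))) = 0 := by
    intro S hS
    rw [Finset.mem_filter] at hS
    have hLS := hS.2
    have hlS : l ∈ S := hLS hl
    have hcompl : (Sᶜ ∪ M)ᶜ = insert l (S \ L) := by
      ext a
      by_cases ha : a = l
      · subst ha; simp [hlS, hlM]
      · simp [hLM, ha]
    have hins : insert l (Sᶜ ∪ M) = Sᶜ ∪ L := by
      rw [hLM, Finset.union_insert]
    have hsum : ∑ t ∈ (Sᶜ ∪ M)ᶜ, w S (insert t (Sᶜ ∪ M)) =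
        w S (Sᶜ ∪ L) + ∑ t ∈ S \ L, w S (insert t (Sᶜ ∪ M)) := by
      rw [hcompl, Finset.sum_insert (by simp [hl]), hins]
    rw [← hsum]
    -- The second factor is empty only for `S = [0, p]` and `L = {l}`.
    rcases (Sᶜ ∪ M).eq_empty_or_nonempty with he | hne
    · rw [he]
      have hSu : S = Finset.univ := by
        rw [Finset.union_eq_empty] at he
        exact Finset.compl_eq_empty_iff S |>.mp he.1
      subst hSu
      simpa using h.sum_univ_singleton hp
    · exact h S _ ⟨l, hlS⟩ hne
  have h2 : ∑ S ∈ Finset.univ.filter (fun S => L ⊆ S), ∑ s ∈ Sᶜ, w (insert s S) (Sᶜ ∪ M) =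
      ∑ S ∈ Finset.univ.filter (fun S => L ⊆ S), ∑ t ∈ S \ L, w S (insert t (Sᶜ ∪ M)) := by
    rw [Finset.sum_sigma', Finset.sum_sigma']
    refine Finset.sum_bij' (fun x _ => ⟨insert x.2 x.1, x.2⟩) (fun x _ => ⟨x.1.erase x.2, x.2⟩)
      ?_ ?_ ?_ ?_ ?_
    · rintro ⟨S, s⟩ hx
      simp only [Finset.mem_sigma, Finset.mem_filter, Finset.mem_univ, true_and,
        Finset.mem_compl, Finset.mem_sdiff, Finset.mem_insert, true_or] at hx ⊢
      exact ⟨hx.1.trans (Finset.subset_insert _ _), fun h => hx.2 (hx.1 h)⟩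
    · rintro ⟨S, s⟩ hx
      simp only [Finset.mem_sigma, Finset.mem_filter, Finset.mem_univ, true_and,
        Finset.mem_compl, Finset.mem_sdiff, Finset.notMem_erase, not_false_eq_true,
        and_true] at hx ⊢
      exact Finset.subset_erase.mpr ⟨hx.1, hx.2.2⟩
    · rintro ⟨S, s⟩ hx
      simp only [Finset.mem_sigma, Finset.mem_compl] at hx
      simp [Finset.erase_insert hx.2]
    · rintro ⟨S, s⟩ hx
      simp only [Finset.mem_sigma, Finset.mem_sdiff] at hx
      simp [Finset.insert_erase hx.2.1]
    · rintro ⟨S, s⟩ hx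
      simp only [Finset.mem_sigma, Finset.mem_compl] at hx
      have : Sᶜ ∪ M = insert s ((insert s S)ᶜ ∪ M) := by
        ext a
        by_cases ha : a = s
        · subst ha; simp [hx.2]
        · simp [ha]
      rw [← this]
  have h3 := Finset.sum_congr (rfl : (Finset.univ.filter fun S => L ⊆ S) = _) h1
  rw [Finset.sum_add_distrib, Finset.sum_add_distrib, h2, Finset.sum_const_zero,
    add_left_comm, CharTwo.add_self_eq_zero, add_zero] at h3
  exact h3

/-! ### Tight families of coefficients -/

theorem union_inter_iff {p : ℕ} {S T L : Finset (Fin (p + 1))} :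
    S ∪ T = Finset.univ ∧ S ∩ T = L ↔ L ⊆ S ∧ T = Sᶜ ∪ L := by
  constructor
  · rintro ⟨hu, rfl⟩
    refine ⟨Finset.inter_subset_left, ?_⟩
    ext a
    have := Finset.mem_univ a
    rw [← hu, Finset.mem_union] at this
    simp only [Finset.mem_union, Finset.mem_compl, Finset.mem_inter]
    tauto
  · rintro ⟨hL, rfl⟩
    constructor
    · ext a; simp; tauto
    · ext a
      have := @hL a
      simp only [Finset.mem_union, Finset.mem_compl, Finset.mem_inter]
      tauto

/-- Exactly one pair `S ⊗ T` occurs for each possible value `L` of `S ∩ T`; it satisfies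
`S ∪ T = [0, p]` and has an odd coefficient. -/
structure Tight {p : ℕ} (i : ℕ) (c : Finset (Fin (p + 1)) → Finset (Fin (p + 1)) → ℤ) : Prop where
  union_eq : ∀ {S T}, c S T ≠ 0 → S ∪ T = Finset.univ
  card_inter : ∀ {S T}, c S T ≠ 0 → (S ∩ T).card = i + 1
  inj : ∀ {S T S' T'}, c S T ≠ 0 → c S' T' ≠ 0 → S ∩ T = S' ∩ T' → S = S'
  exists_odd : ∀ L : Finset (Fin (p + 1)), L.card = i + 1 →
    ∃ S T, S ∪ T = Finset.univ ∧ S ∩ T = L ∧ Odd (c S T)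

theorem card_inter_eq {p i : ℕ} {S T : Finset (Fin (p + 1))} (hu : S ∪ T = Finset.univ)
    (hd : S.card + T.card = p + i + 2) : (S ∩ T).card = i + 1 := by
  have := Finset.card_union_add_card_inter S T
  rw [hu, Finset.card_univ, Fintype.card_fin] at this
  omega

theorem Tight.sum_eq_one {p i : ℕ} {c : Finset (Fin (p + 1)) → Finset (Fin (p + 1)) → ℤ}
    (hc : Tight i c) {L : Finset (Fin (p + 1))} (hL : L.card = i + 1) :
    ∑ S ∈ Finset.univ.filter (fun S => L ⊆ S), (c S (Sᶜ ∪ L) : ZMod 2) = 1 := by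
  obtain ⟨S₀, T₀, hu, hi, ho⟩ := hc.exists_odd L hL
  obtain ⟨hLS, rfl⟩ := union_inter_iff.mp ⟨hu, hi⟩
  have hne : c S₀ (S₀ᶜ ∪ L) ≠ 0 := by
    intro h
    rw [h] at ho
    exact absurd ho (by decide)
  rw [Finset.sum_eq_single S₀]
  · exact ZMod.intCast_eq_one_iff_odd.mpr ho
  · intro S hS hSS
    rw [Finset.mem_filter] at hS
    by_contra hcne
    have hcne' : c S (Sᶜ ∪ L) ≠ 0 := by
      intro h0
      rw [h0] at hcne
      exact hcne (by simp)
    exact hSS (hc.inj hcne' hne ((union_inter_iff.mpr ⟨hS.2, rfl⟩).2.trans hi.symm))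
  · intro hn
    exact absurd (Finset.mem_filter.mpr ⟨Finset.mem_univ _, hLS⟩) hn

/-- A family of coefficients with the minimal number of terms that differs from a tight family by
a cycle is tight. -/
theorem Tight.of_card_le {p i : ℕ} (hp : 1 ≤ p)
    {c d : Finset (Fin (p + 1)) → Finset (Fin (p + 1)) → ℤ} (hc : Tight i c)
    (hd : ∀ S T, d S T ≠ 0 → S.card + T.card = p + i + 2)
    (hz : FormalCycle fun S T => d S T - c S T)
    (hcard : (Finset.univ.filter fun ST : Finset (Fin (p + 1)) × Finset (Fin (p + 1)) =>
      d ST.1 ST.2 ≠ 0).card ≤ (p + 1).choose (i + 1)) : Tight i d := by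
  have hodd : ∀ L : Finset (Fin (p + 1)), L.card = i + 1 →
      ∃ S T, S ∪ T = Finset.univ ∧ S ∩ T = L ∧ Odd (d S T) := by
    intro L hL
    have h0 := hz.modTwo.sum_eq_zero hp (L := L) (Finset.card_pos.mp (by omega))
    simp only [Int.cast_sub, Finset.sum_sub_distrib, hc.sum_eq_one hL] at h0
    have h1 : ∑ S ∈ Finset.univ.filter (fun S => L ⊆ S), (d S (Sᶜ ∪ L) : ZMod 2) ≠ 0 := by
      rw [sub_eq_zero.mp h0]
      exact one_ne_zero
    obtain ⟨S, hS, hne⟩ := Finset.exists_ne_zero_of_sum_ne_zero h1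
    obtain ⟨hu, hi⟩ := union_inter_iff.mpr ⟨(Finset.mem_filter.mp hS).2, rfl⟩
    refine ⟨S, Sᶜ ∪ L, hu, hi, ?_⟩
    by_contra hn
    rw [Int.not_odd_iff_even] at hn
    exact hne (ZMod.intCast_eq_zero_iff_even.mpr hn)
  set F := Finset.univ.filter fun ST : Finset (Fin (p + 1)) × Finset (Fin (p + 1)) =>
    d ST.1 ST.2 ≠ 0 with hF
  set G := F.filter fun ST => ST.1 ∪ ST.2 = Finset.univ with hG
  have hmaps : ∀ ST ∈ G, ST.1 ∩ ST.2 ∈ Finset.powersetCard (i + 1)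
      (Finset.univ : Finset (Fin (p + 1))) := by
    intro ST hST
    rw [hG, hF, Finset.mem_filter, Finset.mem_filter] at hST
    exact Finset.mem_powersetCard.mpr
      ⟨Finset.subset_univ _, card_inter_eq hST.2 (hd _ _ hST.1.2)⟩
  have hsurj : ∀ L ∈ Finset.powersetCard (i + 1) (Finset.univ : Finset (Fin (p + 1))),
      ∃ ST ∈ G, ST.1 ∩ ST.2 = L := by
    intro L hL
    obtain ⟨S, T, hu, hi, ho⟩ := hodd L (Finset.mem_powersetCard.mp hL).2
    refine ⟨(S, T), ?_, hi⟩
    rw [hG, hF, Finset.mem_filter, Finset.mem_filter]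
    refine ⟨⟨Finset.mem_univ _, fun h => ?_⟩, hu⟩
    rw [h] at ho
    exact absurd ho (by decide)
  have hchoose : (Finset.powersetCard (i + 1) (Finset.univ : Finset (Fin (p + 1)))).card =
      (p + 1).choose (i + 1) := by simp
  have hFP : F.card ≤ (Finset.powersetCard (i + 1)
      (Finset.univ : Finset (Fin (p + 1)))).card := by rw [hchoose]; exact hcard
  -- Intersection maps the covering pairs `G` onto the sets `L`, and all of `F` has at most as many
  -- elements as there are `L`. Hence `G = F` and the map is injective.
  have hPG : (Finset.powersetCard (i + 1) (Finset.univ : Finset (Fin (p + 1)))).card ≤ G.card :=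
    Finset.card_le_card_of_surjOn (fun ST => ST.1 ∩ ST.2) fun L hL => by
      obtain ⟨ST, h, h'⟩ := hsurj L hL
      exact ⟨ST, h, h'⟩
  have hGF : G = F := Finset.eq_of_subset_of_card_le (Finset.filter_subset _ _) (hFP.trans hPG)
  have hinj := Finset.injOn_of_surjOn_of_card_le
    (fun ST : Finset (Fin (p + 1)) × Finset (Fin (p + 1)) => ST.1 ∩ ST.2)
    (s := G) (t := Finset.powersetCard (i + 1) (Finset.univ : Finset (Fin (p + 1))))
    (fun ST h => hmaps ST h) (fun L hL => by
      obtain ⟨ST, h, h'⟩ := hsurj L hL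
      exact ⟨ST, h, h'⟩) (by rw [hGF]; exact hFP)
  have hmem : ∀ {S T}, d S T ≠ 0 → (S, T) ∈ G := fun {S T} h => by
    rw [hGF, hF, Finset.mem_filter]
    exact ⟨Finset.mem_univ _, h⟩
  have hun : ∀ {S T}, d S T ≠ 0 → S ∪ T = Finset.univ := fun h =>
    (Finset.mem_filter.mp (hmem h)).2
  exact ⟨hun, fun h => card_inter_eq (hun h) (hd _ _ h),
    fun h h' he => congrArg Prod.fst (hinj (hmem h) (hmem h') he), hodd⟩

/-! ### Uniqueness of tight families modulo cycles -/

theorem FormalCycle.sub {p : ℕ} {z w : Finset (Fin (p + 1)) → Finset (Fin (p + 1)) → ℤ}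
    (hz : FormalCycle z) (hw : FormalCycle w) : FormalCycle fun S T => z S T - w S T := by
  intro S T hS hT
  have h1 := hz S T hS hT
  have h2 := hw S T hS hT
  simp only [mul_sub, Finset.sum_sub_distrib]
  linarith

theorem sign_mul_add_sign_mul_eq_zero {m n : ℕ} {a b : ℤ}
    (h : (-1 : ℤ) ^ m * a + (-1 : ℤ) ^ n * b = 0) : a = 0 ↔ b = 0 := by
  rcases neg_one_pow_eq_or ℤ m with hm | hm <;> rcases neg_one_pow_eq_or ℤ n with hn | hn <;>
    rw [hm, hn] at h <;> omega

/-- In the condition at `S ⊗ T` only the two summands that add `j` can cover `[0, p]`, so they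
cancel each other. -/
theorem FormalCycle.eq_zero_iff {p : ℕ} {z : Finset (Fin (p + 1)) → Finset (Fin (p + 1)) → ℤ}
    (hz : FormalCycle z) (hu : ∀ S T, z S T ≠ 0 → S ∪ T = Finset.univ)
    {S T : Finset (Fin (p + 1))} (hS : S.Nonempty) (hT : T.Nonempty) {j : Fin (p + 1)}
    (hjS : j ∉ S) (hjT : j ∉ T) : z (insert j S) T = 0 ↔ z S (insert j T) = 0 := by
  have h := hz S T hS hT
  rw [Finset.sum_eq_single j, Finset.sum_eq_single j] at h
  · exact sign_mul_add_sign_mul_eq_zero h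
  · intro t _ htj
    rw [mul_eq_zero_of_right]
    by_contra hne
    have := Finset.mem_univ j
    rw [← hu _ _ hne] at this
    simp only [Finset.mem_union, Finset.mem_insert] at this
    rcases this with h | h | h
    · exact hjS h
    · exact htj h.symm
    · exact hjT h
  · intro h
    exact absurd (Finset.mem_compl.mpr hjT) h
  · intro t _ htj
    rw [mul_eq_zero_of_right]
    by_contra hne
    have := Finset.mem_univ j
    rw [← hu _ _ hne] at this
    simp only [Finset.mem_union, Finset.mem_insert] at this
    rcases this with (h | h) | h
    · exact htj h.symm
    · exact hjS h
    · exact hjT h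
  · intro h
    exact absurd (Finset.mem_compl.mpr hjS) h

/-- A vertex outside `S ∩ T` can be moved from one side to the other in the support of a cycle
all of whose terms cover `[0, p]`. -/
theorem FormalCycle.exists_toggle {p : ℕ} {z : Finset (Fin (p + 1)) → Finset (Fin (p + 1)) → ℤ}
    (hz : FormalCycle z) (hu : ∀ S T, z S T ≠ 0 → S ∪ T = Finset.univ)
    {S T : Finset (Fin (p + 1))} (hST : z S T ≠ 0) (hne : (S ∩ T).Nonempty) {j : Fin (p + 1)}
    (hj : j ∉ S ∩ T) :
    ∃ S' T', z S' T' ≠ 0 ∧ S' ∩ T' = S ∩ T ∧ (j ∈ S' ↔ j ∉ S) ∧ ∀ a, a ≠ j → (a ∈ S' ↔ a ∈ S) := by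
  obtain ⟨l, hl⟩ := hne
  have hlj : l ≠ j := fun h => hj (h ▸ hl)
  rw [Finset.mem_inter] at hl hj
  by_cases hjS : j ∈ S
  · have hjT : j ∉ T := fun h => hj ⟨hjS, h⟩
    refine ⟨S.erase j, insert j T, ?_, ?_, by simp [hjS], fun a ha => by simp [ha]⟩
    · have := hz.eq_zero_iff hu (S := S.erase j) (T := T) ⟨l, Finset.mem_erase.mpr ⟨hlj, hl.1⟩⟩
        ⟨l, hl.2⟩ (Finset.notMem_erase j S) hjT
      rw [Finset.insert_erase hjS] at this
      exact fun h => hST (this.mpr h)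
    · ext a
      by_cases ha : a = j
      · subst ha; simp [hjT]
      · simp [ha]
  · have hjT : j ∈ T := by
      have := Finset.mem_univ j
      rw [← hu _ _ hST, Finset.mem_union] at this
      exact this.resolve_left hjS
    refine ⟨insert j S, T.erase j, ?_, ?_, by simp [hjS], fun a ha => by simp [ha]⟩
    · have := hz.eq_zero_iff hu (S := S) (T := T.erase j) ⟨l, hl.1⟩
        ⟨l, Finset.mem_erase.mpr ⟨hlj, hl.2⟩⟩ hjS (Finset.notMem_erase j T)
      rw [Finset.insert_erase hjT] at this
      exact fun h => hST (this.mp h)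
    · ext a
      by_cases ha : a = j
      · subst ha; simp [hjS]
      · simp [ha]

theorem Tight.union_eq_of_sub_ne_zero {p i : ℕ}
    {c d : Finset (Fin (p + 1)) → Finset (Fin (p + 1)) → ℤ} (hc : Tight i c) (hd : Tight i d)
    (S T : Finset (Fin (p + 1))) (h : d S T - c S T ≠ 0) : S ∪ T = Finset.univ := by
  by_cases h0 : d S T = 0
  · exact hc.union_eq (S := S) (T := T) (by omega)
  · exact hd.union_eq h0

/-- In dimensions `p ≥ i + 2`, tight families that differ by a cycle are equal. -/
theorem Tight.eq_of_formalCycle {p i : ℕ} (hp : i + 2 ≤ p)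
    {c d : Finset (Fin (p + 1)) → Finset (Fin (p + 1)) → ℤ} (hc : Tight i c) (hd : Tight i d)
    (hz : FormalCycle fun S T => d S T - c S T) : d = c := by
  funext S T
  by_contra hne
  have hST : d S T - c S T ≠ 0 := sub_ne_zero.mpr hne
  have hu := hc.union_eq_of_sub_ne_zero hd
  have hcard : (S ∩ T).card = i + 1 := by
    by_cases h0 : d S T = 0
    · exact hc.card_inter (S := S) (T := T) (by omega)
    · exact hd.card_inter h0
  have hLne : (S ∩ T).Nonempty := Finset.card_pos.mp (by omega)
  -- The complement has `p - i ≥ 2` elements. Moving `j` or `k` gives two further pairs over the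
  -- same intersection, and two of the three pairs must belong to the same tight family.
  have hcompl : 1 < ((S ∩ T)ᶜ).card := by
    rw [Finset.card_compl, Fintype.card_fin]
    omega
  obtain ⟨j, hj, k, hk, hjk⟩ := Finset.one_lt_card.mp hcompl
  rw [Finset.mem_compl] at hj hk
  obtain ⟨S₁, T₁, h₁, hi₁, hj₁, ha₁⟩ := hz.exists_toggle hu hST hLne hj
  obtain ⟨S₂, T₂, h₂, hi₂, hk₂, ha₂⟩ := hz.exists_toggle hu hST hLne hk
  have n01 : S ≠ S₁ := fun h => by rw [← h] at hj₁; tauto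
  have n02 : S ≠ S₂ := fun h => by rw [← h] at hk₂; tauto
  have n12 : S₁ ≠ S₂ := fun h => by
    have := ha₂ j hjk
    rw [← h, hj₁] at this
    tauto
  have key : ∀ A B : Finset (Fin (p + 1)), d A B - c A B ≠ 0 → d A B ≠ 0 ∨ c A B ≠ 0 := by
    intro A B h
    omega
  rcases key S T hST with e | e <;> rcases key S₁ T₁ h₁ with e₁ | e₁ <;>
    rcases key S₂ T₂ h₂ with e₂ | e₂
  · exact n01 (hd.inj e e₁ hi₁.symm)
  · exact n01 (hd.inj e e₁ hi₁.symm)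
  · exact n02 (hd.inj e e₂ hi₂.symm)
  · exact n12 (hc.inj e₁ e₂ (hi₁.trans hi₂.symm))
  · exact n12 (hd.inj e₁ e₂ (hi₁.trans hi₂.symm))
  · exact n02 (hc.inj e e₂ hi₂.symm)
  · exact n01 (hc.inj e e₁ hi₁.symm)
  · exact n01 (hc.inj e e₁ hi₁.symm)

theorem eq_univ_or_of_card {p : ℕ} {S T : Finset (Fin (p + 1))}
    (h : S.card + T.card = 2 * p + 1) :
    (S = Finset.univ ∧ ∃ j, T = {j}ᶜ) ∨ (T = Finset.univ ∧ ∃ j, S = {j}ᶜ) := by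
  have hS := Finset.card_add_card_compl S
  have hT := Finset.card_add_card_compl T
  rw [Fintype.card_fin] at hS hT
  have key : ∀ U : Finset (Fin (p + 1)), Uᶜ.card = 1 → ∃ j, U = {j}ᶜ := fun U hU => by
    obtain ⟨j, hj⟩ := Finset.card_eq_one.mp hU
    exact ⟨j, by rw [← hj, compl_compl]⟩
  rcases Nat.eq_zero_or_pos Sᶜ.card with h0 | h0
  · exact Or.inl ⟨(Finset.compl_eq_empty_iff S).mp (Finset.card_eq_zero.mp h0),
      key T (by omega)⟩
  · exact Or.inr ⟨(Finset.compl_eq_empty_iff T).mp (Finset.card_eq_zero.mp (by omega)),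
      key S (by omega)⟩

/-- A cycle of degree `2 p - 1` is determined by any one of its coefficients. -/
theorem FormalCycle.eq_zero_of_exists {p : ℕ} (hp : 1 ≤ p)
    {z : Finset (Fin (p + 1)) → Finset (Fin (p + 1)) → ℤ} (hz : FormalCycle z)
    (hdeg : ∀ S T, z S T ≠ 0 → S.card + T.card = 2 * p + 1) {S₀ T₀ : Finset (Fin (p + 1))}
    (h₀ : S₀.card + T₀.card = 2 * p + 1) (hz₀ : z S₀ T₀ = 0) (S T : Finset (Fin (p + 1))) :
    z S T = 0 := by
  have hne : ∀ j : Fin (p + 1), ({j}ᶜ : Finset (Fin (p + 1))).Nonempty := fun j =>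
    Finset.card_pos.mp (by rw [Finset.card_compl]; simp; omega)
  -- The condition at `{k}ᶜ ⊗ {j}ᶜ` has just two summands. It links every pair of the first kind
  -- with every pair of the second, so all coefficients vanish together.
  have key : ∀ j k : Fin (p + 1), z Finset.univ {j}ᶜ = 0 ↔ z {k}ᶜ Finset.univ = 0 := by
    intro j k
    have h := hz {k}ᶜ {j}ᶜ (hne k) (hne j)
    rw [compl_compl, compl_compl, Finset.sum_singleton, Finset.sum_singleton,
      Finset.insert_compl_self, Finset.insert_compl_self] at h
    exact sign_mul_add_sign_mul_eq_zero h
  have hall : (∀ j, z Finset.univ {j}ᶜ = 0) ∧ ∀ k, z {k}ᶜ Finset.univ = 0 := by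
    rcases eq_univ_or_of_card h₀ with ⟨rfl, j, rfl⟩ | ⟨rfl, k, rfl⟩
    · exact ⟨fun j' => (key j' j).mpr ((key j j).mp hz₀), fun k => (key j k).mp hz₀⟩
    · exact ⟨fun j => (key j k).mpr hz₀, fun k' => (key k k').mp ((key k k).mpr hz₀)⟩
  by_contra hST
  rcases eq_univ_or_of_card (hdeg S T hST) with ⟨rfl, j, rfl⟩ | ⟨rfl, k, rfl⟩
  · exact hST (hall.1 j)
  · exact hST (hall.2 k)

/-- In dimension `i + 1`, a tight family that differs by cycles from two opposite tight families
is equal to one of them. -/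
theorem Tight.eq_or_eq_of_formalCycle {i : ℕ}
    {c c' d : Finset (Fin (i + 1 + 1)) → Finset (Fin (i + 1 + 1)) → ℤ}
    (hc : Tight i c) (hc' : Tight i c') (hd : Tight i d)
    (hopp : ∀ S T, c' S T ≠ 0 → c T S ≠ 0)
    (hz : FormalCycle fun S T => d S T - c S T) (hz' : FormalCycle fun S T => c' S T - c S T) :
    d = c ∨ d = c' := by
  have hdeg : ∀ {e : Finset (Fin (i + 1 + 1)) → Finset (Fin (i + 1 + 1)) → ℤ}, Tight i e →
      ∀ S T, e S T ≠ 0 → S.card + T.card = 2 * (i + 1) + 1 := by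
    intro e he S T h
    have := Finset.card_union_add_card_inter S T
    rw [he.union_eq h, he.card_inter h, Finset.card_univ, Fintype.card_fin] at this
    omega
  by_cases hzero : ∀ S T, d S T - c S T = 0
  · left
    funext S T
    exact sub_eq_zero.mp (hzero S T)
  right
  have hall : ∀ S T : Finset (Fin (i + 1 + 1)), S.card + T.card = 2 * (i + 1) + 1 →
      d S T - c S T ≠ 0 := by
    intro S T hST h0
    refine hzero (hz.eq_zero_of_exists (by omega) (fun A B hAB => ?_) hST h0)
    by_cases hdA : d A B = 0
    · exact hdeg hc A B (by omega)
    · exact hdeg hd A B hdA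
  -- Any `L` would do. The difference `d - c` vanishes nowhere in this degree and `c T S = 0`, so
  -- `d` contains `T ⊗ S` and, being tight, not `S ⊗ T`. Nor does `c'`, so `d - c'` is a cycle with
  -- a zero coefficient.
  obtain ⟨S, T, hu, hi, ho⟩ := hc.exists_odd ({0}ᶜ) (by rw [Finset.card_compl]; simp)
  have hcST : c S T ≠ 0 := fun h => by rw [h] at ho; exact absurd ho (by decide)
  have hne : S ≠ T := by
    rintro rfl
    rw [Finset.union_self] at hu
    rw [Finset.inter_self, hu] at hi
    have := Finset.mem_univ (0 : Fin (i + 1 + 1))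
    rw [hi] at this
    simp at this
  have hcard := hdeg hc S T hcST
  have hcTS : c T S = 0 := by
    by_contra h
    exact hne (hc.inj hcST h (Finset.inter_comm S T))
  have hdTS : d T S ≠ 0 := by
    have := hall T S (by omega)
    omega
  have hdST : d S T = 0 := by
    by_contra h
    exact hne (hd.inj h hdTS (Finset.inter_comm S T))
  have hcST' : c' S T = 0 := by
    by_contra h
    exact hopp S T h hcTS
  have hcyc : FormalCycle fun S T => d S T - c' S T := by
    have := hz.sub hz'
    simpa using this
  funext A B
  refine sub_eq_zero.mp (hcyc.eq_zero_of_exists (by omega) (fun A B hAB => ?_) hcard (by omega) A B)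
  by_cases hdA : d A B = 0
  · exact hdeg hc' A B (by omega)
  · exact hdeg hd A B hdA

/-! ### The formulas of `Δ_i^∅` and of its opposite -/

theorem inter_of_initialVertex {p : ℕ} (L : Finset (Fin (p + 1))) :
    (L ∪ initialVertex ∅ L) ∩ (L ∪ coInitialVertex ∅ L) = L := by
  ext a
  simp only [coInitialVertex, Finset.mem_inter, Finset.mem_union, Finset.mem_compl]
  tauto

theorem union_of_initialVertex {p : ℕ} (L : Finset (Fin (p + 1))) :
    (L ∪ initialVertex ∅ L) ∪ (L ∪ coInitialVertex ∅ L) = Finset.univ := by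
  ext a
  simp only [coInitialVertex, Finset.mem_union, Finset.mem_compl, Finset.mem_univ, iff_true]
  tauto

/-- The formula of the coproduct `Δ_i^∅`. -/
def emptyFormula (i : ℕ) : Formula i where
  coeff p S T :=
    if (S ∩ T).card = i + 1 ∧ S = S ∩ T ∪ initialVertex ∅ (S ∩ T) ∧
        T = S ∩ T ∪ coInitialVertex ∅ (S ∩ T) then
      (-1) ^ signExponent (S ∩ T) (initialVertex ∅ (S ∩ T)) (coInitialVertex ∅ (S ∩ T))
    else 0
  degree p S T h := by
    rw [ite_ne_right_iff] at h
    obtain ⟨⟨hc, hS, hT⟩, -⟩ := h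
    have := Finset.card_union_add_card_inter S T
    have hu : S ∪ T = Finset.univ :=
      (congrArg₂ (· ∪ ·) hS hT).trans (union_of_initialVertex (S ∩ T))
    rw [hu, hc, Finset.card_univ, Fintype.card_fin] at this
    omega

theorem emptyFormula_coeff_ne_zero {i p : ℕ} {S T : Finset (Fin (p + 1))}
    (h : (emptyFormula i).coeff p S T ≠ 0) :
    (S ∩ T).card = i + 1 ∧ S = S ∩ T ∪ initialVertex ∅ (S ∩ T) ∧
        T = S ∩ T ∪ coInitialVertex ∅ (S ∩ T) :=
  (ite_ne_right_iff.mp h).1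

theorem emptyFormula_coeff {i p : ℕ} {L : Finset (Fin (p + 1))} (hL : L.card = i + 1) :
    (emptyFormula i).coeff p (L ∪ initialVertex ∅ L) (L ∪ coInitialVertex ∅ L) =
      (-1) ^ signExponent L (initialVertex ∅ L) (coInitialVertex ∅ L) := by
  simp only [emptyFormula, inter_of_initialVertex]
  rw [if_pos ⟨hL, trivial, trivial⟩]

theorem tight_emptyFormula (i p : ℕ) : Tight i ((emptyFormula i).coeff p) where
  union_eq h := by
    obtain ⟨-, hS, hT⟩ := emptyFormula_coeff_ne_zero h
    exact (congrArg₂ (· ∪ ·) hS hT).trans (union_of_initialVertex _)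
  card_inter h := (emptyFormula_coeff_ne_zero h).1
  inj h h' he := by
    rw [(emptyFormula_coeff_ne_zero h).2.1, (emptyFormula_coeff_ne_zero h').2.1, he]
  exists_odd L hL := by
    refine ⟨_, _, union_of_initialVertex L, inter_of_initialVertex L, ?_⟩
    rw [emptyFormula_coeff hL]
    exact Odd.pow (by decide)

theorem emptyFormula_value (i : ℕ) {p : ℕ} (σ : SingularSimplex X p) :
    (emptyFormula i).value σ = cubillageValue i ∅ σ := by
  rw [Formula.value, cubillageValue, ← Finset.sum_product']
  symm
  refine Finset.sum_of_injOn (fun L => (L ∪ initialVertex ∅ L, L ∪ coInitialVertex ∅ L)) ?_ ?_ ?_ ?_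
  · intro L _ L' _ h
    have h1 := congrArg (fun ST : Finset (Fin (p + 1)) × Finset (Fin (p + 1)) => ST.1 ∩ ST.2) h
    simpa only [inter_of_initialVertex] using h1
  · intro L _
    simp
  · rintro ⟨S, T⟩ _ hn
    have : (emptyFormula i).coeff p S T = 0 := by
      by_contra h
      obtain ⟨hc, hS, hT⟩ := emptyFormula_coeff_ne_zero h
      exact hn ⟨S ∩ T, by simpa using hc, Prod.ext hS.symm hT.symm⟩
    simp only [this]
    exact zero_smul ℤ _
  · intro L hL
    simp only [emptyFormula_coeff (Finset.mem_powersetCard.mp hL).2]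

/-- The formula of the opposite coproduct `(-1)^i T Δ`. -/
def Formula.opposite {i : ℕ} (Ψ : Formula i) : Formula i where
  coeff p S T := (-1) ^ i * (-1) ^ ((T.card - 1) * (S.card - 1)) * Ψ.coeff p T S
  degree p S T h := by
    rw [add_comm]
    exact Ψ.degree p T S (right_ne_zero_of_mul h)

theorem Formula.opposite_value {i : ℕ} (Ψ : Formula i) {p : ℕ} (σ : SingularSimplex X p) :
    Ψ.opposite.value σ = (-1 : ℤ) ^ i • swap X (Ψ.value σ) := by
  rw [Formula.value, Formula.value, Finset.sum_comm, map_sum, Finset.smul_sum]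
  refine Finset.sum_congr rfl fun S _ => ?_
  rw [map_sum, Finset.smul_sum]
  refine Finset.sum_congr rfl fun T _ => ?_
  rw [map_smul, swap_faceChain, smul_smul, smul_smul]
  congr 1
  simp only [Formula.opposite]
  ring

theorem Formula.tight_opposite {i p : ℕ} {Ψ : Formula i} (h : Tight i (Ψ.coeff p)) :
    Tight i (Ψ.opposite.coeff p) := by
  have hne : ∀ {S T}, Ψ.opposite.coeff p S T ≠ 0 → Ψ.coeff p T S ≠ 0 := fun h =>
    right_ne_zero_of_mul h
  refine ⟨fun h0 => ?_, fun h0 => ?_, fun {S T S' T'} h0 h0' he => ?_, fun L hL => ?_⟩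
  · rw [Finset.union_comm]
    exact h.union_eq (hne h0)
  · rw [Finset.inter_comm]
    exact h.card_inter (hne h0)
  · have hu := h.union_eq (hne h0)
    have hu' := h.union_eq (hne h0')
    rw [Finset.inter_comm S T, Finset.inter_comm S' T'] at he
    have hT := h.inj (hne h0) (hne h0') he
    subst hT
    rw [(union_inter_iff.mp ⟨hu, rfl⟩).2, (union_inter_iff.mp ⟨hu', rfl⟩).2, he]
  · obtain ⟨S, T, hu, hi, ho⟩ := h.exists_odd L hL
    refine ⟨T, S, by rw [Finset.union_comm, hu], by rw [Finset.inter_comm, hi], ?_⟩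
    exact ((Odd.pow (by decide)).mul (Odd.pow (by decide))).mul ho

theorem Formula.coproduct_simplexChain {i : ℕ} (Ψ : Formula i) {p : ℕ} (σ : SingularSimplex X p) :
    Ψ.coproduct X (simplexChain σ) = Ψ.value σ :=
  linearCombination_simplexChain _ σ

theorem emptyFormula_coproduct (X : Type*) [TopologicalSpace X] (i : ℕ) :
    (emptyFormula i).coproduct X = deltaEmpty X i := by
  apply chains_hom_ext
  intro p σ
  rw [Formula.coproduct_simplexChain, emptyFormula_value, deltaEmpty_simplexChain]

theorem Formula.opposite_coproduct {i : ℕ} (Ψ : Formula i) (X : Type*) [TopologicalSpace X] :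
    Ψ.opposite.coproduct X = (-1 : ℤ) ^ i • (swap X ∘ₗ Ψ.coproduct X) := by
  apply chains_hom_ext
  intro p σ
  rw [Formula.coproduct_simplexChain, Formula.opposite_value, LinearMap.smul_apply,
    LinearMap.comp_apply, Formula.coproduct_simplexChain]

/-! ### The opposite coproduct satisfies the homotopy formula -/

/-- `T` is a chain map; only the signs need comparison. -/
theorem tensorBoundary_swap_faceChain {p : ℕ} (σ : SingularSimplex X p)
    (S T : Finset (Fin (p + 1))) :
    tensorBoundary X (swap X (faceChain σ S ⊗ₜ[ℤ] faceChain σ T)) =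
      swap X (tensorBoundary X (faceChain σ S ⊗ₜ[ℤ] faceChain σ T)) := by
  rcases S.eq_empty_or_nonempty with rfl | hS
  · simp
  rcases T.eq_empty_or_nonempty with rfl | hT
  · simp
  rw [swap_faceChain, map_smul, tensorBoundary_faceChain, tensorBoundary_faceChain, map_add,
    map_sum, map_sum, smul_add, add_comm, Finset.smul_sum, Finset.smul_sum]
  congr 1
  · refine Finset.sum_congr rfl fun s hs => ?_
    rw [map_smul, swap_faceChain, smul_smul, smul_smul, ← pow_add, ← pow_add]
    -- If `S` is a single vertex, `card - 1` truncates and the exponents need not match, but the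
    -- face is zero.
    rcases (S.erase s).eq_empty_or_nonempty with he | hne
    · rw [he]
      simp
    · congr 1
      have hc := Finset.card_erase_of_mem hs
      have h1 := hne.card_pos
      apply neg_one_pow_eq_of_mod
      obtain ⟨n, hn⟩ : ∃ n, S.card = n + 2 := ⟨S.card - 2, by omega⟩
      rw [hc, hn, show n + 2 - 1 = n + 1 by omega, Nat.add_sub_cancel, add_mul]
      omega
  · refine Finset.sum_congr rfl fun t ht => ?_
    rw [map_smul, swap_faceChain, smul_smul, smul_smul, ← pow_add, ← pow_add]
    rcases (T.erase t).eq_empty_or_nonempty with he | hne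
    · rw [he]
      simp
    · congr 1
      have hc := Finset.card_erase_of_mem ht
      have h1 := hne.card_pos
      apply neg_one_pow_eq_of_mod
      obtain ⟨n, hn⟩ : ∃ n, T.card = n + 2 := ⟨T.card - 2, by omega⟩
      rw [hc, hn, show n + 2 - 1 = n + 1 by omega, Nat.add_sub_cancel, mul_add]
      omega

theorem swap_swap_faceChain {p : ℕ} (σ : SingularSimplex X p) (S T : Finset (Fin (p + 1))) :
    swap X (swap X (faceChain σ S ⊗ₜ[ℤ] faceChain σ T)) = faceChain σ S ⊗ₜ[ℤ] faceChain σ T := by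
  rw [swap_faceChain, map_smul, swap_faceChain, smul_smul, ← pow_add, mul_comm (T.card - 1),
    Even.neg_one_pow ⟨_, rfl⟩, one_smul]

theorem Formula.tensorBoundary_swap_value {i : ℕ} (Ψ : Formula i) {p : ℕ}
    (σ : SingularSimplex X p) :
    tensorBoundary X (swap X (Ψ.value σ)) = swap X (tensorBoundary X (Ψ.value σ)) := by
  rw [Formula.value, map_sum, map_sum, map_sum, map_sum]
  refine Finset.sum_congr rfl fun S _ => ?_
  rw [map_sum, map_sum, map_sum, map_sum]
  refine Finset.sum_congr rfl fun T _ => ?_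
  rw [map_smul, map_smul, map_smul, map_smul, tensorBoundary_swap_faceChain]

theorem Formula.swap_swap_value {i : ℕ} (Ψ : Formula i) {p : ℕ} (σ : SingularSimplex X p) :
    swap X (swap X (Ψ.value σ)) = Ψ.value σ := by
  rw [Formula.value, map_sum, map_sum]
  refine Finset.sum_congr rfl fun S _ => ?_
  rw [map_sum, map_sum]
  refine Finset.sum_congr rfl fun T _ => ?_
  rw [map_smul, map_smul, swap_swap_faceChain]

theorem swap_swap_deltaEmptyPred (i : ℕ) {p : ℕ} (σ : SingularSimplex X p) :
    swap X (swap X (deltaEmptyPred X i (simplexChain σ))) =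
      deltaEmptyPred X i (simplexChain σ) := by
  cases i with
  | zero => simp [deltaEmptyPred]
  | succ i =>
    rw [deltaEmptyPred, deltaEmpty_simplexChain, ← emptyFormula_value, Formula.swap_swap_value]

theorem homotopyFormula_apply {i : ℕ} {D : Chains X →ₗ[ℤ] Chains X ⊗[ℤ] Chains X}
    (h : HomotopyFormula i D) (x : Chains X) :
    tensorBoundary X (D x) - (-1 : ℤ) ^ i • D (boundary X x) =
      deltaEmptyPred X i x + (-1 : ℤ) ^ i • swap X (deltaEmptyPred X i x) :=
  LinearMap.congr_fun h x

/-- `T` is an involutive chain map on the values involved, and `(-1)^i T (1 + (-1)^i T) = 1 + (-1)^i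
T`. -/
theorem Formula.homotopyFormula_opposite {i : ℕ} {Ψ : Formula i}
    (h : HomotopyFormula i (Ψ.coproduct X)) : HomotopyFormula i (Ψ.opposite.coproduct X) := by
  apply chains_hom_ext
  intro p σ
  have h1 := congrArg (fun x => (-1 : ℤ) ^ i • swap X x) (homotopyFormula_apply h (simplexChain σ))
  rw [LinearMap.sub_apply, LinearMap.smul_apply, LinearMap.comp_apply, LinearMap.comp_apply,
    LinearMap.comp_apply, LinearMap.add_apply, LinearMap.smul_apply, LinearMap.id_apply,
    Formula.opposite_coproduct, LinearMap.smul_apply, LinearMap.smul_apply, LinearMap.comp_apply,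
    LinearMap.comp_apply, map_smul, Formula.coproduct_simplexChain,
    Formula.tensorBoundary_swap_value]
  simp only [Formula.coproduct_simplexChain] at h1
  rw [map_sub, map_add, map_smul, map_smul, swap_swap_deltaEmptyPred, smul_sub, smul_add] at h1
  have hsq : (-1 : ℤ) ^ i * (-1 : ℤ) ^ i = 1 := by rw [← pow_add, Even.neg_one_pow ⟨i, rfl⟩]
  rw [h1, smul_smul, hsq, one_smul, add_comm]

/-! ### Comparison of admissible formulas -/

theorem sub_smul_tensor (m n : ℤ) (x : Chains X ⊗[ℤ] Chains X) :
    (m - n) • x = m • x - n • x := by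
  exact sub_smul m n x

theorem Formula.formalValue_sub {i : ℕ} (Φ Ψ : Formula i) {p : ℕ} (σ : SingularSimplex X p) :
    formalValue (fun S T => Φ.coeff p S T - Ψ.coeff p S T) σ = Φ.value σ - Ψ.value σ := by
  rw [formalValue, Formula.value, Formula.value, ← Finset.sum_sub_distrib]
  refine Finset.sum_congr rfl fun S _ => ?_
  rw [← Finset.sum_sub_distrib]
  refine Finset.sum_congr rfl fun T _ => ?_
  exact sub_smul_tensor _ _ _

theorem Formula.degree_of_sub_ne_zero {i : ℕ} (Φ Ψ : Formula i) {p : ℕ}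
    {S T : Finset (Fin (p + 1))} (h : Φ.coeff p S T - Ψ.coeff p S T ≠ 0) :
    S.card + T.card = p + i + 2 := by
  by_cases h0 : Φ.coeff p S T = 0
  · exact Ψ.degree p S T (by omega)
  · exact Φ.degree p S T h0

/-- Two formulas satisfying the homotopy formula differ in dimension `p` by a cycle if they agree
in dimension `p - 1`. -/
theorem Formula.formalCycle_sub (hX : ∃ x y : X, x ≠ y ∧ Joined x y) {i : ℕ} {Φ Ψ : Formula i}
    (hΦ : HomotopyFormula i (Φ.coproduct X)) (hΨ : HomotopyFormula i (Ψ.coproduct X)) {p : ℕ}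
    (hp : ∀ q, q + 1 = p → Φ.coeff q = Ψ.coeff q) :
    FormalCycle fun S T => Φ.coeff p S T - Ψ.coeff p S T := by
  refine formalCycle_of_tensorBoundary_eq_zero hX (fun S T h => ?_) fun σ => ?_
  · have := Formula.degree_of_sub_ne_zero Φ Ψ h
    omega
  · have hbd : Φ.coproduct X (boundary X (simplexChain σ)) =
        Ψ.coproduct X (boundary X (simplexChain σ)) := by
      rw [boundary_simplexChain, map_sum, map_sum]
      refine Finset.sum_congr rfl fun j _ => ?_
      rw [map_smul, map_smul]
      rcases (Finset.univ.erase j).eq_empty_or_nonempty with he | hne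
      · rw [he]
        simp
      · rw [faceChain_of_nonempty σ hne, Formula.coproduct_simplexChain,
          Formula.coproduct_simplexChain, Formula.value, Formula.value, hp]
        have h1 := hne.card_pos
        have h2 := Finset.card_erase_of_mem (Finset.mem_univ j)
        rw [Finset.card_univ, Fintype.card_fin] at h2
        omega
    have h1 := homotopyFormula_apply hΦ (simplexChain σ)
    rw [← homotopyFormula_apply hΨ (simplexChain σ), hbd, sub_left_inj] at h1
    rw [Formula.formalValue_sub, map_sub, ← Formula.coproduct_simplexChain Φ,
      ← Formula.coproduct_simplexChain Ψ, h1, sub_self]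

/-- Both formulas are zero there, since `|S| + |T| ≤ 2 p + 2 < p + i + 2`. -/
theorem Formula.coeff_eq_of_lt {i : ℕ} (Φ Ψ : Formula i) {p : ℕ} (hp : p < i) :
    Φ.coeff p = Ψ.coeff p := by
  funext S T
  refine sub_eq_zero.mp (not_not.mp fun h => ?_)
  have h1 := Formula.degree_of_sub_ne_zero Φ Ψ h
  have h2 := Finset.card_le_univ S
  have h3 := Finset.card_le_univ T
  rw [Fintype.card_fin] at h2 h3
  omega

theorem Formula.eq_univ_of_coeff_sub_ne_zero {i : ℕ} (Φ Ψ : Formula i)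
    {S T : Finset (Fin (i + 1))} (h : Φ.coeff i S T - Ψ.coeff i S T ≠ 0) :
    S = Finset.univ ∧ T = Finset.univ := by
  have h1 := Formula.degree_of_sub_ne_zero Φ Ψ h
  have h2 := Finset.card_le_univ S
  have h3 := Finset.card_le_univ T
  rw [Fintype.card_fin] at h2 h3
  rw [← Finset.card_eq_iff_eq_univ, ← Finset.card_eq_iff_eq_univ, Fintype.card_fin]
  omega

/-- Admissible formulas of degree `i` agree in dimension `i`. -/
theorem Formula.coeff_eq_self (hX : ∃ x y : X, x ≠ y ∧ Joined x y) {i : ℕ} {Φ Ψ : Formula i}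
    (hΦ : HomotopyFormula i (Φ.coproduct X)) (hΨ : HomotopyFormula i (Ψ.coproduct X))
    (nΦ : Normalized i (Φ.coproduct X)) (nΨ : Normalized i (Ψ.coproduct X)) :
    Φ.coeff i = Ψ.coeff i := by
  have huniv : Φ.coeff i Finset.univ Finset.univ - Ψ.coeff i Finset.univ Finset.univ = 0 := by
    rcases Nat.eq_zero_or_pos i with rfl | hi
    · obtain ⟨σ, φ, hφ⟩ := exists_coeff_functional hX (p := 0) Finset.univ_nonempty
        Finset.univ_nonempty (Or.inr (by omega))
      have h1 : formalValue (fun S T => Φ.coeff 0 S T - Ψ.coeff 0 S T) σ = 0 := by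
        rw [Formula.formalValue_sub, ← Formula.coproduct_simplexChain Φ,
          ← Formula.coproduct_simplexChain Ψ, nΦ rfl, nΨ rfl, sub_self]
      have h2 : formalValue (fun S T => Φ.coeff 0 S T - Ψ.coeff 0 S T) σ =
          (Φ.coeff 0 Finset.univ Finset.univ - Ψ.coeff 0 Finset.univ Finset.univ) •
            (faceChain σ Finset.univ ⊗ₜ[ℤ] faceChain σ Finset.univ) := by
        rw [formalValue, Finset.sum_eq_single Finset.univ, Finset.sum_eq_single Finset.univ]
        · intro T _ hT
          have : Φ.coeff 0 Finset.univ T - Ψ.coeff 0 Finset.univ T = 0 := by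
            by_contra h
            exact hT (Formula.eq_univ_of_coeff_sub_ne_zero Φ Ψ h).2
          rw [this]
          exact zero_smul ℤ _
        · exact fun h => absurd (Finset.mem_univ _) h
        · intro S _ hS
          refine Finset.sum_eq_zero fun T _ => ?_
          have : Φ.coeff 0 S T - Ψ.coeff 0 S T = 0 := by
            by_contra h
            exact hS (Formula.eq_univ_of_coeff_sub_ne_zero Φ Ψ h).1
          rw [this]
          exact zero_smul ℤ _
        · exact fun h => absurd (Finset.mem_univ _) h
      have h3 := congrArg φ (h2.symm.trans h1)
      rw [map_smul, hφ, map_zero, if_pos ⟨rfl, rfl⟩, smul_eq_mul, mul_one] at h3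
      exact h3
    -- For `i > 0` the cycle condition at `{0}ᶜ ⊗ [0, i]` has a single summand, the coefficient of
    -- `[0, i] ⊗ [0, i]`. For `i = 0` this facet is empty, and the normalization was used instead.
    · have hcyc := Formula.formalCycle_sub hX hΦ hΨ (p := i) fun q hq =>
        Formula.coeff_eq_of_lt Φ Ψ (by omega)
      have hne : ({0}ᶜ : Finset (Fin (i + 1))).Nonempty :=
        Finset.card_pos.mp (by rw [Finset.card_compl]; simp; omega)
      have h := hcyc {0}ᶜ Finset.univ hne Finset.univ_nonempty
      rw [compl_compl, Finset.sum_singleton, Finset.insert_compl_self, Finset.compl_univ,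
        Finset.sum_empty, add_zero] at h
      exact (mul_eq_zero.mp h).resolve_left (pow_ne_zero _ (by decide))
  funext S T
  refine sub_eq_zero.mp (not_not.mp fun h => ?_)
  obtain ⟨rfl, rfl⟩ := Formula.eq_univ_of_coeff_sub_ne_zero Φ Ψ h
  exact h huniv

theorem Formula.coproduct_congr {i : ℕ} {Φ Ψ : Formula i} (h : ∀ p, Φ.coeff p = Ψ.coeff p) :
    Φ.coproduct X = Ψ.coproduct X := by
  apply chains_hom_ext
  intro p σ
  rw [Formula.coproduct_simplexChain, Formula.coproduct_simplexChain, Formula.value,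
    Formula.value, h]

/-- A formula with few terms that agrees with an admissible tight formula in dimensions up to
`i + 1` agrees with it in all dimensions. -/
theorem Formula.coeff_eq_of_agree (hX : ∃ x y : X, x ≠ y ∧ Joined x y) {i : ℕ} {Φ Ψ : Formula i}
    (hΦ : HomotopyFormula i (Φ.coproduct X)) (hΨ : HomotopyFormula i (Ψ.coproduct X))
    (hcard : ∀ p, Φ.numTerms p ≤ (p + 1).choose (i + 1)) (hT : ∀ p, Tight i (Ψ.coeff p))
    (hlow : ∀ p, p ≤ i + 1 → Φ.coeff p = Ψ.coeff p) (p : ℕ) : Φ.coeff p = Ψ.coeff p := by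
  induction p with
  | zero => exact hlow 0 (by omega)
  | succ p ih =>
    by_cases hp : p + 1 ≤ i + 1
    · exact hlow _ hp
    · have hcyc := Formula.formalCycle_sub hX hΦ hΨ (p := p + 1) fun q hq => by
        obtain rfl : q = p := by omega
        exact ih
      exact (hT _).eq_of_formalCycle (by omega)
        ((hT _).of_card_le (by omega) (Φ.degree _) hcyc (hcard _)) hcyc

theorem emptyFormula_numTerms (i p : ℕ) :
    (emptyFormula i).numTerms p ≤ (p + 1).choose (i + 1) := by
  have hchoose : (Finset.powersetCard (i + 1) (Finset.univ : Finset (Fin (p + 1)))).card =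
      (p + 1).choose (i + 1) := by simp
  rw [← hchoose, Formula.numTerms]
  refine Finset.card_le_card_of_injOn (fun ST => ST.1 ∩ ST.2) ?_ ?_
  · rintro ⟨S, T⟩ h
    have h' := emptyFormula_coeff_ne_zero (Finset.mem_filter.mp h).2
    simpa using h'.1
  · rintro ⟨S, T⟩ h ⟨S', T'⟩ h' he
    have h1 := emptyFormula_coeff_ne_zero (Finset.mem_filter.mp h).2
    have h2 := emptyFormula_coeff_ne_zero (Finset.mem_filter.mp h').2
    simp only at he h1 h2
    rw [he] at h1
    exact Prod.ext (h1.2.1.trans h2.2.1.symm) (h1.2.2.trans h2.2.2.symm)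

theorem normalized_of_coeff {i : ℕ} {Ψ : Formula i}
    (h : i = 0 → ∀ S T, Ψ.coeff 0 S T = if S = Finset.univ ∧ T = Finset.univ then 1 else 0) :
    Normalized i (Ψ.coproduct X) := by
  intro hi σ
  rw [Formula.coproduct_simplexChain, Formula.value, Finset.sum_eq_single Finset.univ,
    Finset.sum_eq_single Finset.univ, h hi, if_pos ⟨rfl, rfl⟩, one_smul, faceChain_univ]
  · intro T _ hT
    rw [h hi, if_neg fun h => hT h.2]
    exact zero_smul ℤ _
  · exact fun h => absurd (Finset.mem_univ _) h
  · intro S _ hS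
    refine Finset.sum_eq_zero fun T _ => ?_
    rw [h hi, if_neg fun h => hS h.1]
    exact zero_smul ℤ _
  · exact fun h => absurd (Finset.mem_univ _) h

theorem normalized_emptyFormula (X : Type*) [TopologicalSpace X] (i : ℕ) :
    Normalized i ((emptyFormula i).coproduct X) := by
  refine normalized_of_coeff fun hi => ?_
  subst hi
  decide

theorem normalized_opposite_emptyFormula (X : Type*) [TopologicalSpace X] (i : ℕ) :
    Normalized i ((emptyFormula i).opposite.coproduct X) := by
  refine normalized_of_coeff fun hi => ?_
  subst hi
  decide

end CupCoproduct

end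

/-! ### Conclusion: the choice in dimension `i + 1` determines the coproduct -/

open CupCoproduct in
theorem theorem4p6 {X : Type*} [TopologicalSpace X]
    (hX : ∃ x y : X, x ≠ y ∧ Joined x y)
    (i : ℕ) (D : CupCoproduct.Chains X →ₗ[ℤ] CupCoproduct.Chains X ⊗[ℤ] CupCoproduct.Chains X)
    (Φ : CupCoproduct.Formula i)
    (hD : ∀ (p : ℕ) (σ : CupCoproduct.SingularSimplex X p),
      D (CupCoproduct.simplexChain σ) = Φ.value σ)
    (hhom : CupCoproduct.HomotopyFormula i D)
    (hnorm : CupCoproduct.Normalized i D)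
    (hmin : ∀ Ψ : CupCoproduct.Formula i,
      CupCoproduct.HomotopyFormula i (Ψ.coproduct X) → CupCoproduct.Normalized i (Ψ.coproduct X) →
        ∀ p : ℕ, Φ.numTerms p ≤ Ψ.numTerms p) :
    D = CupCoproduct.deltaEmpty X i ∨
      D = (-1 : ℤ) ^ i • (CupCoproduct.swap X ∘ₗ CupCoproduct.deltaEmpty X i) := by
  obtain rfl : D = Φ.coproduct X := by
    apply chains_hom_ext
    intro p σ
    rw [hD, Formula.coproduct_simplexChain]
  have hΨ : HomotopyFormula i ((emptyFormula i).coproduct X) := by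
    rw [emptyFormula_coproduct]
    exact homotopyFormula_deltaEmpty X i
  have hΨ' := Formula.homotopyFormula_opposite hΨ
  have nΨ := normalized_emptyFormula X i
  have nΨ' := normalized_opposite_emptyFormula X i
  -- Minimality enters only through the comparison with `Δ_i^∅`.
  have hcard : ∀ p, Φ.numTerms p ≤ (p + 1).choose (i + 1) := fun p =>
    (hmin _ hΨ nΨ p).trans (emptyFormula_numTerms i p)
  have hT := tight_emptyFormula i
  have hT' : ∀ p, Tight i ((emptyFormula i).opposite.coeff p) := fun p =>
    Formula.tight_opposite (hT p)
  have low : ∀ {Ψ : Formula i}, HomotopyFormula i (Ψ.coproduct X) →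
      Normalized i (Ψ.coproduct X) → ∀ p, p ≤ i → Φ.coeff p = Ψ.coeff p := by
    intro Ψ h n p hp
    rcases hp.lt_or_eq with hp | rfl
    · exact Formula.coeff_eq_of_lt Φ Ψ hp
    · exact Formula.coeff_eq_self hX hhom h hnorm n
  have hcyc := Formula.formalCycle_sub hX hhom hΨ (p := i + 1) fun q hq =>
    low hΨ nΨ q (by omega)
  -- `Δ_i^∅` and its opposite agree up to dimension `i` because each agrees there with `Φ`.
  have hcyc' := Formula.formalCycle_sub hX hΨ' hΨ (p := i + 1) fun q hq => by
    rw [← low hΨ nΨ q (by omega), ← low hΨ' nΨ' q (by omega)]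
  have hΦT := (hT _).of_card_le (by omega) (Φ.degree _) hcyc (hcard _)
  have finish : ∀ {Ψ : Formula i}, HomotopyFormula i (Ψ.coproduct X) →
      Normalized i (Ψ.coproduct X) → (∀ p, Tight i (Ψ.coeff p)) →
      Φ.coeff (i + 1) = Ψ.coeff (i + 1) → Φ.coproduct X = Ψ.coproduct X := by
    intro Ψ h n t e
    refine Formula.coproduct_congr (Formula.coeff_eq_of_agree hX hhom h hcard t fun p hp => ?_)
    rcases Nat.lt_or_eq_of_le hp with hp | rfl
    · exact low h n p (by omega)
    · exact e
  rcases (hT _).eq_or_eq_of_formalCycle (hT' _) hΦT (fun S T h => right_ne_zero_of_mul h) hcyc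
    hcyc' with h | h
  · left
    rw [finish hΨ nΨ hT h, emptyFormula_coproduct]
  · right
    rw [finish hΨ' nΨ' hT' h, Formula.opposite_coproduct, emptyFormula_coproduct]
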